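/- Let $(M,\omega)$ be a symplectic manifold of dimension $2n$, let $L\subset M$ be a Lagrangian submanifold and $U\subset M$ an open set. Write $B(R)\subset\mathbb C^n$ for the closed ball of radius $R>0$ about $0$, $\omega_0=\sum_j dx_j\wedge dy_j$ for the standard symplectic form and $j$ for the standard complex structure of $\mathbb C^n$. Let $(e,J_0)$ be a $(U,L)$-adapted pair of radius $R$: $e:(B(R),\omega_0)\to(M,\omega)$ is a symplectic embedding with $e(B(R))\subset U$ and $e^{-1}(L)=B(R)\cap\mathbb R^n$, and $J_0$ is an $\omega$-compatible almost complex structure on $M$ with $J_0=e_*j$ on $e(B(R))$. Let $\Sigma$ be a compact connected Riemann surface with (possibly empty) boundary $\partial\Sigma=\partial_-\Sigma\cup\partial_+\Sigma$, where $\partial_-\Sigma\cap\partial_+\Sigma$ is a finite set of corner points. Let $w:\Sigma\to M$ be a continuous map that is smooth (up to the boundary) and $J_0$-holomorphic away from the corner points, and that is somewhere injective: there is a non-corner point $z$ with $dw(z)\ne0$ and $w^{-1}(w(z))=\{z\}$. Suppose that the curve $C=w(\Sigma)$ is properly adapted, i.e. $w(\partial_-\Sigma)\subset L$ and $w(\partial_+\Sigma)\cap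 e(\operatorname{Int}B(R))=\emptyset$, and that it passes through the center, $e(0)\in C$. Then $$\int_{C\cap e(B(r))}\omega\;\ge\;\frac{\pi r^2}{2}\qquad\text{for all } 0<r\le R .$$ Here $C$ is regarded as a subset of $M$: parts of $C$ that are covered several times by $w$ are counted once in the integral (so the same bound holds for $\int_{w^{-1}(e(B(r)))}w^*\omega$). -/

import Mathlib

open Set MeasureTheory
open scoped Manifold ContDiff ENNReal Bundle

noncomputable section

/-- Standard complex space `ℂⁿ`, with its Euclidean norm. -/
abbrev CSpace (n : ℕ) : Type := EuclideanSpace ℂ (Fin n)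

/-- The model space `ℝ²ⁿ` of the `2n`-dimensional manifolds below. -/
abbrev RSpace (n : ℕ) : Type := EuclideanSpace ℝ (Fin (2 * n))

/-! ### Symplectic manifolds, compatible almost complex structures, Lagrangian submanifolds -/

section Symplectic

variable {n : ℕ} {M : Type*} [TopologicalSpace M] [ChartedSpace (RSpace n) M]

/-- The coordinate expression, in the chart at `c`, of a field of bilinear forms on `M`. -/
def coordForm (Ω : ∀ x : M, TangentSpace (𝓡 (2 * n)) x →L[ℝ] TangentSpace (𝓡 (2 * n)) x →L[ℝ] ℝ)
    (c : M) (y : RSpace n) : RSpace n →L[ℝ] RSpace n →L[ℝ] ℝ :=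
  let D : RSpace n →L[ℝ] RSpace n :=
    mfderiv 𝓘(ℝ, RSpace n) (𝓡 (2 * n)) (extChartAt (𝓡 (2 * n)) c).symm y
  let B : RSpace n →L[ℝ] RSpace n →L[ℝ] ℝ := Ω ((extChartAt (𝓡 (2 * n)) c).symm y)
  B.bilinearComp D D

/-- `Ω` is a symplectic form on `M`: a smooth, closed, nondegenerate 2-form. Closedness is the
usual coordinate formula for `dΩ = 0`. -/
structure IsSymplecticForm [IsManifold (𝓡 (2 * n)) ∞ M]
    (Ω : ∀ x : M, TangentSpace (𝓡 (2 * n)) x →L[ℝ] TangentSpace (𝓡 (2 * n)) x →L[ℝ] ℝ) :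
    Prop where
  smooth : ContMDiff (𝓡 (2 * n)) ((𝓡 (2 * n)).prod 𝓘(ℝ, RSpace n →L[ℝ] RSpace n →L[ℝ] ℝ)) ∞
    (fun x ↦ Bundle.TotalSpace.mk' (RSpace n →L[ℝ] RSpace n →L[ℝ] ℝ)
      (E := fun x : M ↦ TangentSpace (𝓡 (2 * n)) x →L[ℝ] TangentSpace (𝓡 (2 * n)) x →L[ℝ] ℝ)
      x (Ω x))
  alternating : ∀ (x : M) (v : TangentSpace (𝓡 (2 * n)) x), Ω x v v = 0
  closed : ∀ (c : M), ∀ y ∈ (extChartAt (𝓡 (2 * n)) c).target, ∀ a b d : RSpace n,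
    fderiv ℝ (coordForm Ω c) y a b d + fderiv ℝ (coordForm Ω c) y b d a
      + fderiv ℝ (coordForm Ω c) y d a b = 0
  nondegenerate : ∀ (x : M) (v : TangentSpace (𝓡 (2 * n)) x), (∀ u, Ω x v u = 0) → v = 0

/-- `J` is a smooth almost complex structure on `M` compatible with `Ω`:
`J² = -1`, `Ω(J·, J·) = Ω`, and `Ω(v, Jv) > 0` for `v ≠ 0`. -/
structure IsCompatible [IsManifold (𝓡 (2 * n)) ∞ M]
    (Ω : ∀ x : M, TangentSpace (𝓡 (2 * n)) x →L[ℝ] TangentSpace (𝓡 (2 * n)) x →L[ℝ] ℝ)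
    (J : ∀ x : M, TangentSpace (𝓡 (2 * n)) x →L[ℝ] TangentSpace (𝓡 (2 * n)) x) : Prop where
  smooth : ContMDiff (𝓡 (2 * n)) ((𝓡 (2 * n)).prod 𝓘(ℝ, RSpace n →L[ℝ] RSpace n)) ∞
    (fun x ↦ Bundle.TotalSpace.mk' (RSpace n →L[ℝ] RSpace n)
      (E := fun x : M ↦ TangentSpace (𝓡 (2 * n)) x →L[ℝ] TangentSpace (𝓡 (2 * n)) x)
      x (J x))
  sq : ∀ (x : M) (v : TangentSpace (𝓡 (2 * n)) x), J x (J x v) = -v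
  invariant : ∀ (x : M) (u v : TangentSpace (𝓡 (2 * n)) x), Ω x (J x u) (J x v) = Ω x u v
  positive : ∀ (x : M) (v : TangentSpace (𝓡 (2 * n)) x), v ≠ 0 → 0 < Ω x v (J x v)

/-- The coordinate subspace `ℝⁿ × 0 ⊆ ℝ²ⁿ`. -/
def sliceSubspace (n : ℕ) : Set (RSpace n) := {y | ∀ i : Fin (2 * n), n ≤ (i : ℕ) → y i = 0}

/-- `L` is an embedded `n`-dimensional submanifold of `M` (given by slice charts) on whose tangent
spaces `Ω` vanishes. -/
def IsLagrangian
    (Ω : ∀ x : M, TangentSpace (𝓡 (2 * n)) x →L[ℝ] TangentSpace (𝓡 (2 * n)) x →L[ℝ] ℝ)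
    (L : Set M) : Prop :=
  ∀ p ∈ L, ∃ φ ∈ IsManifold.maximalAtlas (𝓡 (2 * n)) ∞ M, p ∈ φ.source ∧
    (∀ q ∈ φ.source, q ∈ L ↔ φ q ∈ sliceSubspace n) ∧
    ∀ q ∈ φ.source, q ∈ L → ∀ a b : TangentSpace (𝓡 (2 * n)) q,
      mfderiv (𝓡 (2 * n)) 𝓘(ℝ, RSpace n) φ q a ∈ sliceSubspace n →
      mfderiv (𝓡 (2 * n)) 𝓘(ℝ, RSpace n) φ q b ∈ sliceSubspace n → Ω q a b = 0

/-! ### Adapted pairs -/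

/-- The standard symplectic form `∑ dxⱼ ∧ dyⱼ` on `ℂⁿ`, `zⱼ = xⱼ + i yⱼ`. -/
def stdForm (n : ℕ) (u v : CSpace n) : ℝ :=
  ∑ j, ((u j).re * (v j).im - (u j).im * (v j).re)

/-- The derivative at `x` of a map on the closed ball of radius `R` in `ℂⁿ`. -/
def ballDeriv (R : ℝ) (e : CSpace n → M) (x : CSpace n) :
    CSpace n →L[ℝ] TangentSpace (𝓡 (2 * n)) (e x) :=
  mfderivWithin 𝓘(ℝ, CSpace n) (𝓡 (2 * n)) e (Metric.closedBall 0 R) x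

/-- `e` restricts to a symplectic embedding of the closed ball `B²ⁿ(R) ⊆ ℂⁿ` in `(M, Ω)`. (On this
compact ball an injective smooth symplectic map is an immersion and a topological embedding.) -/
structure IsSymplecticBall
    (Ω : ∀ x : M, TangentSpace (𝓡 (2 * n)) x →L[ℝ] TangentSpace (𝓡 (2 * n)) x →L[ℝ] ℝ)
    (R : ℝ) (e : CSpace n → M) : Prop where
  smooth : ContMDiffOn 𝓘(ℝ, CSpace n) (𝓡 (2 * n)) ∞ e (Metric.closedBall 0 R)
  injOn : InjOn e (Metric.closedBall 0 R)
  symplectic : ∀ x ∈ Metric.closedBall (0 : CSpace n) R, ∀ u v : CSpace n,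
    Ω (e x) (ballDeriv R e x u) (ballDeriv R e x v) = stdForm n u v

/-- `(e, J)` is a `(U, L)`-adapted pair: `e` is a symplectic embedding of the closed ball of radius
`R` with image in `U` and `e⁻¹(L) = B²ⁿ(R) ∩ ℝⁿ`, and `J` is a compatible almost complex structure
on `M` which equals `e_* j` on `e(B²ⁿ(R))`, for the standard complex structure `j` of `ℂⁿ`. -/
structure IsAdaptedPair [IsManifold (𝓡 (2 * n)) ∞ M]
    (Ω : ∀ x : M, TangentSpace (𝓡 (2 * n)) x →L[ℝ] TangentSpace (𝓡 (2 * n)) x →L[ℝ] ℝ)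
    (U L : Set M) (R : ℝ) (e : CSpace n → M)
    (J : ∀ x : M, TangentSpace (𝓡 (2 * n)) x →L[ℝ] TangentSpace (𝓡 (2 * n)) x) : Prop where
  ball : IsSymplecticBall Ω R e
  mapsTo : MapsTo e (Metric.closedBall 0 R) U
  mem_iff : ∀ x ∈ Metric.closedBall (0 : CSpace n) R, e x ∈ L ↔ ∀ i, (x i).im = 0
  compatible : IsCompatible Ω J
  standard : ∀ x ∈ Metric.closedBall (0 : CSpace n) R, ∀ v : CSpace n,
    J (e x) (ballDeriv R e x v) = ballDeriv R e x (Complex.I • v)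

end Symplectic

/-! ### Riemann surfaces with boundary -/

/-- The closed upper half plane. -/
abbrev ClosedHalfPlane : Type := {z : ℂ // 0 ≤ z.im}

theorem range_closedHalfPlane :
    range (Subtype.val : ClosedHalfPlane → ℂ) = {z | 0 ≤ z.im} := Subtype.range_val

theorem convex_closedHalfPlane : Convex ℝ {z : ℂ | 0 ≤ z.im} := convex_halfSpace_im_ge 0

/-- The inclusion of the closed upper half plane in `ℂ`, as a partial equivalence. -/
def closedHalfPlaneEquiv : PartialEquiv ClosedHalfPlane ℂ where
  toFun := Subtype.val
  invFun z := ⟨⟨z.re, max z.im 0⟩, le_max_right _ _⟩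
  source := univ
  target := {z | 0 ≤ z.im}
  map_source' z _ := z.2
  map_target' _ _ := mem_univ _
  left_inv' z _ := Subtype.ext (Complex.ext rfl (max_eq_left z.2))
  right_inv' _ hz := Complex.ext rfl (max_eq_left hz)

theorem continuous_closedHalfPlaneEquiv_symm : Continuous closedHalfPlaneEquiv.invFun := by
  refine Continuous.subtype_mk ?_ _
  have h : Continuous fun z : ℂ ↦ ((z.re : ℝ) : ℂ) + ((max z.im 0 : ℝ) : ℂ) * Complex.I := by
    fun_prop
  convert h using 2 with z
  apply Complex.ext <;> simp

theorem interior_closedHalfPlane_nonempty :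
    (interior (range closedHalfPlaneEquiv)).Nonempty := by
  refine ⟨Complex.I, mem_interior.2 ⟨{z | 0 < z.im}, fun z hz ↦ ?_,
    isOpen_lt continuous_const Complex.continuous_im, by simp⟩⟩
  exact ⟨⟨z, le_of_lt hz⟩, rfl⟩

/-- The closed half plane as a complex model: a space `S` charted on it with
`IsManifold halfPlaneℂ ω S` is a Riemann surface with boundary (holomorphic transition maps, also
at boundary points; here `ω` means analytic over `ℂ`). -/
def halfPlaneℂ : ModelWithCorners ℂ ℂ ClosedHalfPlane where
  toPartialEquiv := closedHalfPlaneEquiv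
  source_eq := rfl
  convex_range' := by
    simp only [instIsRCLikeNormedField, ↓reduceDIte]
    apply Convex.convex_isRCLikeNormedField
    exact (range_closedHalfPlane ▸ convex_closedHalfPlane :
      Convex ℝ (range (Subtype.val : ClosedHalfPlane → ℂ)))
  nonempty_interior' := interior_closedHalfPlane_nonempty
  continuous_toFun := continuous_subtype_val
  continuous_invFun := continuous_closedHalfPlaneEquiv_symm

/-- The closed half plane as a real model, used for real differentiability on a surface. -/
def halfPlaneℝ : ModelWithCorners ℝ ℂ ClosedHalfPlane where
  toPartialEquiv := closedHalfPlaneEquiv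
  source_eq := rfl
  convex_range' := by
    simp only [instIsRCLikeNormedField, ↓reduceDIte]
    apply Convex.convex_isRCLikeNormedField
    exact (range_closedHalfPlane ▸ convex_closedHalfPlane :
      Convex ℝ (range (Subtype.val : ClosedHalfPlane → ℂ)))
  nonempty_interior' := interior_closedHalfPlane_nonempty
  continuous_toFun := continuous_subtype_val
  continuous_invFun := continuous_closedHalfPlaneEquiv_symm

/-! ### Pseudo-holomorphic curves and their area -/

section Curves

variable {n : ℕ} {M : Type*} [TopologicalSpace M] [ChartedSpace (RSpace n) M]
  {S : Type*} [TopologicalSpace S] [ChartedSpace ClosedHalfPlane S]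

/-- The expression of `w : S → M` in the holomorphic chart of `S` at `c`. -/
def inChart (w : S → M) (c : S) (y : ℂ) : M := w ((extChartAt halfPlaneℝ c).symm y)

/-- The derivative of `w` at the point with coordinate `y` in the holomorphic chart at `c`. -/
def chartDeriv (w : S → M) (c : S) (y : ℂ) :
    ℂ →L[ℝ] TangentSpace (𝓡 (2 * n)) (inChart w c y) :=
  mfderivWithin 𝓘(ℝ, ℂ) (𝓡 (2 * n)) (inChart w c) (range halfPlaneℝ) y

/-- `w : S → M` is a somewhere injective `J`-holomorphic map on the Riemann surface with boundary
`S`, where `∂S = ∂₋S ∪ ∂₊S` and `∂₋S ∩ ∂₊S` is a finite set of corner points. At the corner points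
only continuity of `w` is required. -/
structure IsJHolomorphicCurve
    (J : ∀ x : M, TangentSpace (𝓡 (2 * n)) x →L[ℝ] TangentSpace (𝓡 (2 * n)) x)
    (bdMinus bdPlus : Set S) (w : S → M) : Prop where
  boundary_eq : bdMinus ∪ bdPlus = halfPlaneℝ.boundary S
  finite_inter : (bdMinus ∩ bdPlus).Finite
  continuous : Continuous w
  smooth : ContMDiffOn halfPlaneℝ (𝓡 (2 * n)) ∞ w (bdMinus ∩ bdPlus)ᶜ
  holomorphic : ∀ (c : S), ∀ y ∈ (extChartAt halfPlaneℝ c).target,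
    (extChartAt halfPlaneℝ c).symm y ∉ bdMinus ∩ bdPlus → ∀ v : ℂ,
      chartDeriv w c y (Complex.I * v) = J (inChart w c y) (chartDeriv w c y v)
  somewhere_injective : ∃ z : S, z ∉ bdMinus ∩ bdPlus ∧ w ⁻¹' {w z} = {z} ∧
    mfderiv halfPlaneℝ (𝓡 (2 * n)) w z ≠ 0

/-- The curve `w` is properly `(L, e)`-adapted: `w(∂₋S) ⊆ L`, and `w(∂₊S)` does not meet the
image under `e` of the open ball of radius `R`. -/
structure IsProperlyAdapted (L : Set M) (R : ℝ) (e : CSpace n → M)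
    (bdMinus bdPlus : Set S) (w : S → M) : Prop where
  minus : w '' bdMinus ⊆ L
  plus : Disjoint (w '' bdPlus) (e '' Metric.ball 0 R)

/-- `∫_{C ∩ K} Ω`, the `Ω`-area of the part in `K` of the curve `C = w(S)`, for `w` on which `Ω` is
nonnegative (such as a `J`-holomorphic map, `J` compatible with `Ω`). The curve is a subset of `M`,
so that a part covered several times by `w` counts once: cut `C ∩ K` into countably many disjoint
pieces `w(A k)`, with `A k` a measurable subset of a chart of `S` on which `w` is injective, and add
up the integrals of `w*Ω = Ω(∂w/∂s, ∂w/∂t) ds dt`; then take the supremum. -/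
def curveArea [MeasurableSpace S]
    (Ω : ∀ x : M, TangentSpace (𝓡 (2 * n)) x →L[ℝ] TangentSpace (𝓡 (2 * n)) x →L[ℝ] ℝ)
    (w : S → M) (K : Set M) : ℝ≥0∞ :=
  ⨆ (c : ℕ → S) (A : ℕ → Set S)
    (_ : ∀ k, MeasurableSet (A k) ∧ A k ⊆ (chartAt ClosedHalfPlane (c k)).source ∧
      InjOn w (A k) ∧ w '' A k ⊆ K)
    (_ : Pairwise fun k l ↦ Disjoint (w '' A k) (w '' A l)),
    ∑' k, ∫⁻ y in extChartAt halfPlaneℝ (c k) '' A k,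
      ENNReal.ofReal
        (Ω (inChart w (c k) y) (chartDeriv w (c k) y 1) (chartDeriv w (c k) y Complex.I))

end Curves

end

/-! ### The Cauchy transform in the plane -/

/-! In the coordinates of the ball the curve is a map `u = e⁻¹ ∘ w` whose components `u_j` are
holomorphic, and they are real on the part of the boundary that lies in the open ball, because there
the boundary is mapped to `L`, that is, to `ℝⁿ`. The proof follows Alexander's approach through
uniform approximation and needs neither an isoperimetric inequality nor a differential inequality in
`r`.

Let `P_j` be the projection to the `j`-th axis of the part of the curve over the closed `r`-ball,
and let `K_j` be the union of `P_j` and its complex conjugate. By the Ahlfors–Beurling estimate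
there is a holomorphic `g_j` near `K_j`, real on the real axis, with `π |conj z - g_j z|² ≤ area K_j
+ ε` on `K_j` (`exists_differentiableOn_conj_approx`). The function `f = r² - ∑ u_j g_j(u_j)` is
holomorphic along the curve and real on its boundary. By Schwarz reflection the maximum principle
holds at those boundary points too, so `r² = |f|` at the centre is at most `|f(q)|` for some `q`
with `|u(q)| = r`. There `r² = ∑ u_j conj(u_j)`, and Cauchy–Schwarz gives `π r² ≤ ∑ area K_j ≤ 2 ∑
area P_j` (`pi_mul_sq_le_sum_area_projections`). The symmetrisation of `P_j` costs the factor `2` of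
the theorem.

The area density of the curve is `∑ |u_j'|²`, the sum of the Jacobians of its projections. Hence the
area of the curve, with multiple parts counted once, is at least `∑ area P_j`
(`sum_volume_projections_le_curveArea`). This proves the bound for `r < R`, and `r = R` follows in
the limit. -/

theorem locallyIntegrable_inv_sub (z : ℂ) : LocallyIntegrable (fun ζ : ℂ ↦ (z - ζ)⁻¹) := by
  have h0 : ∀ r : ℝ, IntegrableOn (fun ζ : ℂ ↦ ζ⁻¹) (Metric.ball 0 r) := by
    intro r
    have h : IntegrableOn (fun ζ : ℂ ↦ (fun t : ℝ ↦ t⁻¹) ‖ζ‖) (Metric.ball 0 r) := by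
      rw [integrableOn_fun_norm_addHaar]
      have : IntegrableOn (fun _ : ℝ ↦ (1 : ℝ)) (Ioo 0 r) := by simp
      refine this.congr_fun (fun y hy ↦ ?_) measurableSet_Ioo
      have : y ≠ 0 := hy.1.ne'
      simp [this]
    refine Integrable.mono' h (by fun_prop) (ae_of_all _ fun ζ ↦ ?_)
    simp
  have h1 : LocallyIntegrable (fun ζ : ℂ ↦ ζ⁻¹) := by
    intro x
    exact ⟨Metric.ball 0 (‖x‖ + 1), Metric.isOpen_ball.mem_nhds (by simp), h0 _⟩
  intro x
  obtain ⟨s, hs, hsi⟩ := h1 (z - x)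
  refine ⟨(fun ζ ↦ z - ζ) ⁻¹' s, ?_, ?_⟩
  · exact (continuous_const.sub continuous_id).continuousAt.preimage_mem_nhds hs
  · exact ((Measure.measurePreserving_sub_left volume z).integrableOn_comp_preimage
      (MeasurableEquiv.subLeft z).measurableEmbedding).2 hsi

theorem integrableOn_inv_sub {K : Set ℂ} (hK : Bornology.IsBounded K) (z : ℂ) :
    IntegrableOn (fun ζ : ℂ ↦ (z - ζ)⁻¹) K :=
  ((locallyIntegrable_inv_sub z).integrableOn_isCompact hK.isCompact_closure).mono_set
    subset_closure

/-- The pole lies outside the closed disc, so this is the mean value property at the centre. -/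
theorem circleAverage_inv_sub_of_lt {z : ℂ} {s : ℝ} (hs : 0 ≤ s) (h : s < ‖z‖) :
    Real.circleAverage (fun ζ ↦ (z - ζ)⁻¹) 0 s = z⁻¹ := by
  have hne : ∀ ζ ∈ Metric.closedBall (0 : ℂ) s, z - ζ ≠ 0 := by
    intro ζ hζ h0
    rw [sub_eq_zero] at h0
    simp [← h0] at hζ
    linarith
  have hd : DifferentiableOn ℂ (fun ζ ↦ (z - ζ)⁻¹) (Metric.closedBall 0 s) := by
    intro ζ hζ
    have := hne ζ hζ
    fun_prop (disch := assumption)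
  have := circleAverage_of_differentiable_on_off_countable (f := fun ζ ↦ (z - ζ)⁻¹) (c := 0)
    (R := s) (s := ∅) countable_empty (by rw [abs_of_nonneg hs]; exact hd.continuousOn) (by
      rw [abs_of_nonneg hs, sdiff_empty]
      exact fun ζ hζ ↦ (hd.mono Metric.ball_subset_closedBall).differentiableAt
        (Metric.isOpen_ball.mem_nhds hζ))
  simpa using this

/-- Rescaling to the unit circle and substituting `ζ⁻¹` for `ζ` turns the integrand into `ζ / (z ζ -
s)`, which is holomorphic on the closed disc and vanishes at its centre. -/
theorem circleAverage_inv_sub_of_gt {z : ℂ} {s : ℝ} (h : ‖z‖ < s) :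
    Real.circleAverage (fun ζ ↦ (z - ζ)⁻¹) 0 s = 0 := by
  have hs : 0 < s := (norm_nonneg z).trans_lt h
  have hne : ∀ ζ ∈ Metric.closedBall (0 : ℂ) 1, z * ζ - s ≠ 0 := by
    intro ζ hζ h0
    rw [sub_eq_zero] at h0
    have h1 := congrArg norm h0
    rw [norm_mul, Complex.norm_real, Real.norm_of_nonneg hs.le] at h1
    have h2 : ‖ζ‖ ≤ 1 := by simpa using hζ
    nlinarith [norm_nonneg z, norm_nonneg ζ]
  have hd : DifferentiableOn ℂ (fun ζ ↦ ζ / (z * ζ - s)) (Metric.closedBall 0 1) := by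
    intro ζ hζ
    have := hne ζ hζ
    fun_prop (disch := assumption)
  have h3 := circleAverage_of_differentiable_on_off_countable (f := fun ζ ↦ ζ / (z * ζ - s))
    (c := 0) (R := 1) (s := ∅) countable_empty (by simpa using hd.continuousOn) (by
      rw [abs_one, sdiff_empty]
      exact fun ζ hζ ↦ (hd.mono Metric.ball_subset_closedBall).differentiableAt
        (Metric.isOpen_ball.mem_nhds hζ))
  rw [Real.circleAverage_eq_circleAverage_zero_one,
    ← Real.circleAverage_zero_one_congr_inv]
  simp only [add_zero, zero_div, mul_zero] at h3 ⊢
  refine Eq.trans ?_ h3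
  refine Real.circleAverage_congr_sphere (f₁ := fun ζ : ℂ ↦ (z - s * ζ⁻¹)⁻¹)
    (f₂ := fun ζ ↦ ζ / (z * ζ - s)) fun ζ hζ ↦ ?_
  have h0 : ζ ≠ 0 := by rintro rfl; simp at hζ
  have h1 := hne ζ (by simpa using (le_of_eq (by simpa using hζ) : ‖ζ‖ ≤ 1))
  have h2 : z - s * ζ⁻¹ = (z * ζ - s) / ζ := by field_simp
  show (z - s * ζ⁻¹)⁻¹ = _
  rw [h2, inv_div]

/-- In polar coordinates only the circles of radius `s < ‖z‖` contribute, each with average `z⁻¹`;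
the total `π ‖z‖² z⁻¹` is `π conj z`. -/
theorem setIntegral_ball_zero_inv_sub {z : ℂ} {ρ : ℝ} (h : ‖z‖ ≤ ρ) :
    ∫ ζ in Metric.ball 0 ρ, (z - ζ)⁻¹ = Real.pi * (starRingEnd ℂ) z := by
  have hρ : 0 ≤ ρ := (norm_nonneg z).trans h
  set f : ℂ → ℂ := (Metric.ball 0 ρ).indicator fun ζ ↦ (z - ζ)⁻¹ with hf
  have hfm : Measurable f := by
    refine Measurable.indicator (by fun_prop) measurableSet_ball
  have hfi : Integrable f := by
    rw [hf, integrable_indicator_iff measurableSet_ball]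
    exact integrableOn_inv_sub Metric.isBounded_ball z
  set F : ℝ × ℝ → ℂ := fun p ↦ p.1 • f (Complex.polarCoord.symm p) with hF
  have hFm : Measurable F := by
    have : Measurable fun p : ℝ × ℝ ↦ Complex.polarCoord.symm p := by
      simp only [Complex.polarCoord_symm_apply]
      fun_prop
    exact measurable_fst.smul (hfm.comp this)
  have hFi : IntegrableOn F (Ioi (0 : ℝ) ×ˢ Ioo (-Real.pi) Real.pi) := by
    refine ⟨hFm.aestronglyMeasurable, ?_⟩
    have h1 := Complex.lintegral_comp_polarCoord_symm fun p ↦ ‖f p‖ₑ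
    rw [hasFiniteIntegral_iff_enorm]
    refine lt_of_eq_of_lt ?_ hfi.2
    rw [← h1, polarCoord_target]
    refine setLIntegral_congr_fun (measurableSet_Ioi.prod measurableSet_Ioo) fun p hp ↦ ?_
    have h0 : (0 : ℝ) ≤ p.1 := le_of_lt hp.1
    simp only [hF, enorm_smul, smul_eq_mul]
    rw [Real.enorm_eq_ofReal h0]
  have hinner : ∀ s ∈ Ioi (0 : ℝ), ∫ θ in Ioo (-Real.pi) Real.pi, F (s, θ)
      = (if s < ρ then (2 * Real.pi * s) • Real.circleAverage (fun ζ ↦ (z - ζ)⁻¹) 0 s else 0) := by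
    intro s hs
    have hs : 0 < s := hs
    have hcm : ∀ θ : ℝ, Complex.polarCoord.symm (s, θ) = circleMap 0 s θ := by
      intro θ
      simp [circleMap, Complex.exp_mul_I]
    have hball : ∀ θ : ℝ, circleMap 0 s θ ∈ Metric.ball (0 : ℂ) ρ ↔ s < ρ := by
      intro θ
      simp [abs_of_pos hs]
    split_ifs with hsρ
    · have hF' : ∀ θ, F (s, θ) = s • (z - circleMap 0 s θ)⁻¹ := by
        intro θ
        simp only [hF, hcm, hf]
        rw [indicator_of_mem ((hball θ).2 hsρ)]
      simp_rw [hF']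
      rw [integral_smul, ← integral_Ioc_eq_integral_Ioo,
        ← intervalIntegral.integral_of_le (by linarith [Real.pi_pos]),
        Real.circleAverage_def]
      have hp : Function.Periodic (fun θ ↦ (z - circleMap 0 s θ)⁻¹) (2 * Real.pi) := by
        intro θ
        simp [periodic_circleMap 0 s θ]
      have := hp.intervalIntegral_add_eq (-Real.pi) 0
      rw [show -Real.pi + 2 * Real.pi = Real.pi by ring, zero_add] at this
      rw [this, smul_smul]
      congr 1
      field_simp
    · have hF' : ∀ θ, F (s, θ) = 0 := by
        intro θ
        simp only [hF, hcm, hf]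
        rw [indicator_of_notMem fun hh ↦ hsρ ((hball θ).1 hh), smul_zero]
      simp [hF']
  rw [← integral_indicator measurableSet_ball, ← hf, ← Complex.integral_comp_polarCoord_symm,
    polarCoord_target]
  change ∫ p in _, F p = _
  rw [Measure.volume_eq_prod, setIntegral_prod _ hFi, setIntegral_congr_fun measurableSet_Ioi hinner]
  have hae : ∀ᵐ s : ℝ, s ∈ Ioi (0 : ℝ) →
      (if s < ρ then (2 * Real.pi * s) • Real.circleAverage (fun ζ ↦ (z - ζ)⁻¹) 0 s else (0 : ℂ))
      = (Ioc 0 ‖z‖).indicator (fun s : ℝ ↦ (s : ℂ) * (2 * Real.pi * z⁻¹)) s := by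
    have h1 : ∀ᵐ s : ℝ, s ≠ ‖z‖ := by simp [ae_iff, measure_singleton]
    filter_upwards [h1] with s hsz hs
    have hs : 0 < s := hs
    rcases lt_or_gt_of_ne hsz with hlt | hgt
    · rw [if_pos (hlt.trans_le h), circleAverage_inv_sub_of_lt hs.le hlt,
        indicator_of_mem (show s ∈ Ioc 0 ‖z‖ from ⟨hs, hlt.le⟩)]
      simp only [Complex.real_smul]
      push_cast
      ring
    · rw [circleAverage_inv_sub_of_gt hgt, smul_zero, ite_self,
        indicator_of_notMem (fun hh : s ∈ Ioc 0 ‖z‖ ↦ absurd hh.2 (not_le.2 hgt))]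
  rw [setIntegral_congr_ae measurableSet_Ioi hae, setIntegral_indicator measurableSet_Ioc]
  have : Ioi (0 : ℝ) ∩ Ioc 0 ‖z‖ = Ioc 0 ‖z‖ := by
    ext; simp +contextual
  rw [this, ← intervalIntegral.integral_of_le (norm_nonneg z), intervalIntegral.integral_mul_const,
    intervalIntegral.integral_ofReal, integral_id]
  rcases eq_or_ne z 0 with rfl | hz
  · simp
  · have h2 : (starRingEnd ℂ) z = (‖z‖ : ℂ) ^ 2 * z⁻¹ := by
      rw [← Complex.conj_mul' z, mul_assoc, mul_inv_cancel₀ hz, mul_one]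
    rw [h2]
    push_cast
    ring

/-- The Cauchy transform of a disc. -/
theorem setIntegral_ball_inv_sub {z c : ℂ} {ρ : ℝ} (h : ‖z - c‖ ≤ ρ) :
    ∫ ζ in Metric.ball c ρ, (z - ζ)⁻¹ = Real.pi * (starRingEnd ℂ) (z - c) := by
  rw [← setIntegral_ball_zero_inv_sub h]
  have := (measurePreserving_add_right (volume : Measure ℂ) c).setIntegral_preimage_emb
    (MeasurableEquiv.addRight c).measurableEmbedding (fun ζ ↦ (z - ζ)⁻¹) (Metric.ball c ρ)
  rw [← this]
  have hpre : (fun x : ℂ ↦ x + c) ⁻¹' Metric.ball c ρ = Metric.ball 0 ρ := by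
    ext x; simp
  rw [hpre]
  refine setIntegral_congr_fun measurableSet_ball fun ζ _ ↦ ?_
  congr 1
  ring

/-! ### Area bounds for the Cauchy transform and approximation of `conj z` -/

/-- The Ahlfors–Beurling estimate for the Cauchy transform of a bounded set. -/
theorem norm_setIntegral_inv_sub_le {K : Set ℂ} (hK : MeasurableSet K)
    (hKb : Bornology.IsBounded K) (z : ℂ) :
    ‖∫ ζ in K, (z - ζ)⁻¹‖ ≤ √(Real.pi * volume.real K) := by
  set I : ℂ := ∫ ζ in K, (z - ζ)⁻¹ with hI
  rcases (measureReal_nonneg : 0 ≤ volume.real K).eq_or_lt with h0 | hpos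
  · have : volume K = 0 := by
      rcases (ENNReal.toReal_eq_zero_iff _).1 h0.symm with h | h
      · exact h
      · exact absurd h hKb.measure_lt_top.ne
    rw [hI, setIntegral_measure_zero _ this, norm_zero]
    positivity
  -- The rotation `c` makes the integral real and nonnegative, so that only real parts need to be
  -- estimated.
  obtain ⟨c, hc, hcI⟩ : ∃ c : ℂ, ‖c‖ = 1 ∧ c * I = ‖I‖ := by
    rcases eq_or_ne I 0 with h | h
    · exact ⟨1, by simp, by simp [h]⟩
    · have hn : (‖I‖ : ℂ) ≠ 0 := by simpa using h
      refine ⟨‖I‖ / I, by simp [h], by field_simp⟩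
  -- `a` is the radius of a disc with the same area as `K`.
  set a : ℝ := √(volume.real K / Real.pi) with ha
  have hapos : 0 < a := Real.sqrt_pos.2 (div_pos hpos Real.pi_pos)
  have ha2 : Real.pi * a ^ 2 = volume.real K := by
    rw [ha, Real.sq_sqrt (div_pos hpos Real.pi_pos).le]
    field_simp
  have hsq : √(Real.pi * volume.real K) = Real.pi * a := by
    rw [← ha2, show Real.pi * (Real.pi * a ^ 2) = (Real.pi * a) ^ 2 by ring,
      Real.sqrt_sq (by positivity)]
  -- The disc of radius `a` with `z` on its boundary circle, in the direction `c`. Away from `z` the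
  -- real part of `c / (z - ζ)` exceeds `1 / (2a)` exactly inside it, so `D` is the extremal set.
  set D : Set ℂ := Metric.ball (z - a * c) a with hD
  have hDv : volume.real D = Real.pi * a ^ 2 := by
    rw [hD, measureReal_def, Complex.volume_ball]
    simp [hapos.le, mul_comm]
  set φ : ℂ → ℝ := fun ζ ↦ (c * (z - ζ)⁻¹).re - 1 / (2 * a) with hφ
  have hcc : c * (starRingEnd ℂ) c = 1 := by
    rw [Complex.mul_conj, Complex.normSq_eq_norm_sq, hc]; simp
  have hint : ∀ {s : Set ℂ}, Bornology.IsBounded s →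
      IntegrableOn (fun ζ ↦ (c * (z - ζ)⁻¹).re) s := fun {s} hs ↦
    ((integrableOn_inv_sub hs z).const_mul c).re
  have hφi : ∀ {s : Set ℂ}, Bornology.IsBounded s → IntegrableOn φ s := fun {s} hs ↦
    (hint hs).sub (integrableOn_const hs.measure_lt_top.ne)
  have hval : ∀ {s : Set ℂ}, Bornology.IsBounded s →
      ∫ ζ in s, φ ζ = (c * ∫ ζ in s, (z - ζ)⁻¹).re - volume.real s / (2 * a) := by
    intro s hs
    rw [hφ, integral_sub (hint hs) (integrableOn_const hs.measure_lt_top.ne), setIntegral_const,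
      ← integral_const_mul]
    congr 1
    · exact integral_re ((integrableOn_inv_sub hs z).const_mul c)
    · simp [div_eq_mul_inv]
  have hkey : ∀ ζ, ζ ≠ z → (c * (z - ζ)⁻¹).re - 1 / (2 * a)
      = (a ^ 2 - ‖z - ζ - a * c‖ ^ 2) / (2 * a * ‖z - ζ‖ ^ 2) := by
    intro ζ hζ
    have hne : z - ζ ≠ 0 := sub_ne_zero.2 hζ.symm
    have hn : ‖z - ζ‖ ≠ 0 := norm_ne_zero_iff.2 hne
    set η := z - ζ
    have h1 : (c * η⁻¹).re = (c * (starRingEnd ℂ) η).re / ‖η‖ ^ 2 := by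
      rw [Complex.inv_def, ← Complex.normSq_eq_norm_sq, ← mul_assoc, Complex.re_mul_ofReal]
      rfl
    have h2 : ‖η - a * c‖ ^ 2 = ‖η‖ ^ 2 + a ^ 2 - 2 * a * (c * (starRingEnd ℂ) η).re := by
      have h3 : c.re * c.re + c.im * c.im = 1 := by
        rw [← Complex.normSq_apply, Complex.normSq_eq_norm_sq, hc]; norm_num
      rw [← Complex.normSq_eq_norm_sq, ← Complex.normSq_eq_norm_sq, Complex.normSq_apply,
        Complex.normSq_apply]
      simp
      linear_combination a ^ 2 * h3
    rw [h1, h2]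
    field_simp
    ring
  have hnonneg : ∀ ζ ∈ D, 0 ≤ φ ζ := by
    intro ζ hζ
    have h1 : ‖ζ - (z - a * c)‖ < a := by simpa [hD, dist_eq_norm] using hζ
    have h2 : ‖z - ζ - a * c‖ < a := by
      rwa [← norm_neg, show -(z - ζ - a * c) = ζ - (z - a * c) by ring]
    have h3 : ζ ≠ z := by
      rintro rfl
      simp [hc, abs_of_pos hapos] at h2
    rw [hφ]
    simp only
    rw [hkey ζ h3]
    refine div_nonneg ?_ (by positivity)
    nlinarith [norm_nonneg (z - ζ - a * c)]
  have hnonpos : ∀ ζ, ζ ∉ D → φ ζ ≤ 0 := by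
    intro ζ hζ
    rcases eq_or_ne ζ z with rfl | h3
    · simp [hφ, hapos.le]
    have h1 : a ≤ ‖ζ - (z - a * c)‖ := by simpa [hD, dist_eq_norm] using hζ
    have h2 : a ≤ ‖z - ζ - a * c‖ := by
      rwa [← norm_neg, show -(z - ζ - a * c) = ζ - (z - a * c) by ring]
    rw [hφ]
    simp only
    rw [hkey ζ h3]
    refine div_nonpos_of_nonpos_of_nonneg ?_ (by positivity)
    nlinarith [norm_nonneg (z - ζ - a * c)]
  have hDb : Bornology.IsBounded D := Metric.isBounded_ball
  -- Bathtub principle: `φ` is nonnegative on `D` and nonpositive off it. As `K` and `D` have equal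
  -- area, the constant `1 / (2a)` then cancels.
  have hcomp : ∫ ζ in K, φ ζ ≤ ∫ ζ in D, φ ζ := by
    rw [← integral_inter_add_sdiff (s := K) (t := D) measurableSet_ball (hφi hKb),
      ← integral_inter_add_sdiff (s := D) (t := K) hK (hφi hDb), inter_comm K D]
    have h1 : ∫ ζ in K \ D, φ ζ ≤ 0 :=
      setIntegral_nonpos (hK.diff measurableSet_ball) fun ζ hζ ↦ hnonpos ζ hζ.2
    have h2 : 0 ≤ ∫ ζ in D \ K, φ ζ :=
      setIntegral_nonneg (measurableSet_ball.diff hK) fun ζ hζ ↦ hnonneg ζ hζ.1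
    linarith
  rw [hval hKb, hval hDb, ← hI, hcI, hDv, ← ha2,
    setIntegral_ball_inv_sub (by simp [hc, abs_of_pos hapos])] at hcomp
  have h5 : c * (Real.pi * (starRingEnd ℂ) (z - (z - a * c))) = ((Real.pi * a : ℝ) : ℂ) := by
    simp only [sub_sub_cancel, map_mul, Complex.conj_ofReal]
    push_cast
    linear_combination (Real.pi * a : ℂ) * hcc
  rw [h5, Complex.ofReal_re, Complex.ofReal_re] at hcomp
  rw [hsq]
  linarith

/-- The Cauchy transform of a bounded set is holomorphic off the set. -/
theorem differentiableOn_setIntegral_inv_sub {K O : Set ℂ} (hKb : Bornology.IsBounded K)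
    (hKm : MeasurableSet K) (hO : IsOpen O) (h : Disjoint K O) :
    DifferentiableOn ℂ (fun z ↦ ∫ ζ in K, (z - ζ)⁻¹) O := by
  intro z hz
  obtain ⟨δ, hδ, hball⟩ := Metric.isOpen_iff.1 hO z hz
  have hfar : ∀ ζ ∈ K, ∀ x ∈ Metric.ball z (δ / 2), δ / 2 ≤ ‖x - ζ‖ := by
    intro ζ hζ x hx
    by_contra! hlt
    refine h.le_bot ⟨hζ, hball ?_⟩
    have h1 : dist ζ x < δ / 2 := by rwa [dist_comm, dist_eq_norm]
    have := dist_triangle ζ x z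
    rw [Metric.mem_ball] at hx ⊢
    linarith
  refine DifferentiableAt.differentiableWithinAt ?_
  refine (hasDerivAt_integral_of_dominated_loc_of_deriv_le
    (F := fun z ζ : ℂ ↦ (z - ζ)⁻¹) (F' := fun z ζ : ℂ ↦ -((z - ζ) ^ 2)⁻¹)
    (μ := volume.restrict K) (s := Metric.ball z (δ / 2)) (bound := fun _ ↦ ((δ / 2) ^ 2)⁻¹)
    (Metric.ball_mem_nhds z (by positivity)) ?_ (integrableOn_inv_sub hKb z) ?_ ?_ ?_ ?_
    ).2.differentiableAt
  · exact Filter.Eventually.of_forall fun x ↦ (integrableOn_inv_sub hKb x).1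
  · exact Measurable.aestronglyMeasurable (by fun_prop)
  · filter_upwards [ae_restrict_mem hKm] with ζ hζ x hx
    have h1 := hfar ζ hζ x hx
    rw [norm_neg, norm_inv, norm_pow]
    gcongr
  · exact integrableOn_const hKb.measure_lt_top.ne
  · filter_upwards [ae_restrict_mem hKm] with ζ hζ x hx
    have h1 := hfar ζ hζ x hx
    have h2 : x - ζ ≠ 0 := norm_pos_iff.1 (lt_of_lt_of_le (by positivity) h1)
    have := ((hasDerivAt_id x).sub_const ζ).inv h2
    simpa [neg_div, Pi.inv_def] using this

/-- Alexander's quantitative form of the Hartogs–Rosenthal theorem: on a compact set that is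
symmetric about the real axis, `conj z` is within `√(area / π)` of a holomorphic function that is
real on the real axis. -/
theorem exists_differentiableOn_conj_approx {K : Set ℂ} (hK : IsCompact K)
    (hsymm : ∀ z ∈ K, (starRingEnd ℂ) z ∈ K) {ε : ℝ} (hε : 0 < ε) :
    ∃ (O : Set ℂ) (g : ℂ → ℂ), IsOpen O ∧ K ⊆ O ∧ DifferentiableOn ℂ g O ∧
      (∀ x : ℂ, x.im = 0 → (g x).im = 0) ∧
      ∀ z ∈ K, Real.pi * ‖(starRingEnd ℂ) z - g z‖ ^ 2 ≤ volume.real K + ε := by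
  obtain ⟨W, hKW, hWo, hW⟩ := K.exists_isOpen_lt_add hK.measure_lt_top.ne (μ := volume)
    (ε := ENNReal.ofReal ε) (by simpa using hε)
  obtain ⟨ρ, hρ⟩ := hK.isBounded.subset_ball 0
  set D : Set ℂ := Metric.ball 0 ρ with hD
  -- An open set around `K`, symmetric about the real axis, with area at most `ε` above that of `K`.
  set O : Set ℂ := (W ∩ (starRingEnd ℂ) ⁻¹' W) ∩ D with hOdef
  have hOo : IsOpen O :=
    (hWo.inter (hWo.preimage Complex.continuous_conj)).inter Metric.isOpen_ball
  have hKO : K ⊆ O := fun z hz ↦ ⟨⟨hKW hz, hKW (hsymm z hz)⟩, hρ hz⟩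
  have hOD : O ⊆ D := inter_subset_right
  have hOconj : ∀ z, (starRingEnd ℂ) z ∈ O ↔ z ∈ O := by
    intro z
    simp only [hOdef, hD, mem_inter_iff, mem_preimage, Complex.conj_conj, Metric.mem_ball,
      dist_zero_right, RCLike.norm_conj]
    tauto
  have hOvol : volume.real O ≤ volume.real K + ε := by
    have h1 : volume O ≤ volume K + ENNReal.ofReal ε :=
      (measure_mono (inter_subset_left.trans inter_subset_left)).trans hW.le
    have h2 := ENNReal.toReal_mono (by simp [hK.measure_lt_top.ne]) h1
    rwa [ENNReal.toReal_add hK.measure_lt_top.ne (by simp), ENNReal.toReal_ofReal hε.le] at h2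
  have hDb : Bornology.IsBounded D := Metric.isBounded_ball
  have hDOm : MeasurableSet (D \ O) := measurableSet_ball.diff hOo.measurableSet
  -- On `D` the Cauchy transform of `D` is `π conj z`. With `g` from the part `D \ O`, the error
  -- `conj z - g z` is therefore `π⁻¹` times the Cauchy transform of `O`, to which the
  -- Ahlfors–Beurling estimate applies. The symmetry of `D \ O` makes `g` real on the real axis.
  refine ⟨O, fun z ↦ (Real.pi : ℂ)⁻¹ * ∫ ζ in D \ O, (z - ζ)⁻¹, hOo, hKO, ?_, ?_, ?_⟩
  · exact (differentiableOn_setIntegral_inv_sub (hDb.subset sdiff_subset) hDOm hOo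
      disjoint_sdiff_left).const_mul _
  · intro x hx
    have hxc : (starRingEnd ℂ) x = x := Complex.conj_eq_iff_im.2 hx
    rw [← Complex.conj_eq_iff_im, map_mul, map_inv₀, Complex.conj_ofReal]
    congr 1
    rw [← integral_conj]
    have hpre : (Complex.conjLIE : ℂ → ℂ) ⁻¹' (D \ O) = D \ O := by
      ext z
      simp [hOconj, hD]
    have := Complex.conjLIE.measurePreserving.setIntegral_preimage_emb
      Complex.conjLIE.toHomeomorph.measurableEmbedding (fun ζ ↦ (x - ζ)⁻¹) (D \ O)
    rw [hpre] at this
    rw [← this]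
    refine setIntegral_congr_fun hDOm fun ζ _ ↦ ?_
    simp [map_inv₀, hxc]
  · intro z hz
    have hzD : ‖z‖ ≤ ρ := by
      have := hρ hz
      rw [Metric.mem_ball, dist_zero_right] at this
      exact this.le
    have h1 := integral_inter_add_sdiff (s := D) (t := O) hOo.measurableSet
      (integrableOn_inv_sub hDb z)
    rw [inter_eq_right.2 hOD, setIntegral_ball_zero_inv_sub hzD] at h1
    have hpi : (Real.pi : ℂ) ≠ 0 := by exact_mod_cast Real.pi_ne_zero
    have h2 : (starRingEnd ℂ) z - (Real.pi : ℂ)⁻¹ * ∫ ζ in D \ O, (z - ζ)⁻¹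
        = (Real.pi : ℂ)⁻¹ * ∫ ζ in O, (z - ζ)⁻¹ := by
      have h0 : ∀ A B c : ℂ, B + A = Real.pi * c →
          c - (Real.pi : ℂ)⁻¹ * A = (Real.pi : ℂ)⁻¹ * B := by
        intro A B c h
        field_simp
        linear_combination -h
      exact h0 _ _ _ h1
    have h3 := norm_setIntegral_inv_sub_le hOo.measurableSet (hDb.subset hOD) z
    have h4 : ‖∫ ζ in O, (z - ζ)⁻¹‖ ^ 2 ≤ Real.pi * volume.real O := by
      rw [← Real.sq_sqrt (show 0 ≤ Real.pi * volume.real O by positivity)]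
      gcongr
    rw [h2, norm_mul, norm_inv, Complex.norm_real, Real.norm_of_nonneg Real.pi_pos.le, mul_pow]
    refine le_trans ?_ hOvol
    have : Real.pi * (Real.pi⁻¹ ^ 2 * ‖∫ ζ in O, (z - ζ)⁻¹‖ ^ 2)
      ≤ Real.pi * (Real.pi⁻¹ ^ 2 * (Real.pi * volume.real O)) := by gcongr
    refine this.trans (le_of_eq ?_)
    field_simp

/-! ### Maximum principles up to the boundary -/

/-- The local maximum modulus principle at a boundary point of the half plane for holomorphic
functions that are real on the boundary. -/
theorem eventually_eq_of_isLocalMaxOn_norm_halfPlane_of_im_eq_zero {F : ℂ → ℂ} {y₀ : ℂ}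
    (hy₀ : y₀.im = 0)
    (hd : ∀ᶠ y in nhdsWithin y₀ {y | 0 ≤ y.im}, DifferentiableWithinAt ℂ F {y | 0 ≤ y.im} y)
    (hreal : ∀ᶠ y in nhdsWithin y₀ {y | 0 ≤ y.im}, y.im = 0 → (F y).im = 0)
    (hmax : ∀ᶠ y in nhdsWithin y₀ {y | 0 ≤ y.im}, ‖F y‖ ≤ ‖F y₀‖) :
    ∀ᶠ y in nhdsWithin y₀ {y | 0 ≤ y.im}, F y = F y₀ := by
  set H : Set ℂ := {y | 0 ≤ y.im} with hH
  obtain ⟨δ, hδ, hall⟩ := Metric.mem_nhdsWithin_iff.1 (hd.and (hreal.and hmax))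
  set B := Metric.ball y₀ δ with hB
  have hconj0 : (starRingEnd ℂ) y₀ = y₀ := Complex.conj_eq_iff_im.2 hy₀
  have hBc : ∀ y ∈ B, (starRingEnd ℂ) y ∈ B := by
    intro y hy
    rw [hB, Metric.mem_ball, dist_eq_norm] at hy ⊢
    rwa [← hconj0, ← map_sub, RCLike.norm_conj]
  -- Schwarz reflection of `F` across the real axis.
  set G : ℂ → ℂ := fun y ↦ if 0 ≤ y.im then F y else (starRingEnd ℂ) (F ((starRingEnd ℂ) y))
    with hG
  have hGup : ∀ y ∈ H, G y = F y := fun y hy ↦ if_pos hy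
  have hGdown : ∀ y ∈ B, y.im ≤ 0 → G y = (starRingEnd ℂ) (F ((starRingEnd ℂ) y)) := by
    intro y hyB hy
    rcases hy.lt_or_eq with h | h
    · exact if_neg (not_le.2 h)
    · have h1 : (starRingEnd ℂ) y = y := Complex.conj_eq_iff_im.2 h
      rw [h1, hGup y h.ge, Complex.conj_eq_iff_im.2]
      exact (hall ⟨hyB, h.ge⟩).2.1 h
  have hup : ∀ y ∈ B, y ∈ H → ∀ a, HasDerivWithinAt F a H y → HasDerivWithinAt G a H y :=
    fun y _ hy a ha ↦ ha.congr (fun x hx ↦ hGup x hx) (hGup y hy)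
  have hdown : ∀ y ∈ B, y.im ≤ 0 → ∀ a, HasDerivWithinAt F a H ((starRingEnd ℂ) y) →
      HasDerivWithinAt G ((starRingEnd ℂ) a) {y | y.im ≤ 0} y := by
    intro y hyB hy a ha
    have h1 : HasDerivWithinAt ((starRingEnd ℂ) ∘ F ∘ (starRingEnd ℂ)) ((starRingEnd ℂ) a)
        {y | y.im ≤ 0} y := by
      rw [hasDerivWithinAt_iff_tendsto_slope] at ha ⊢
      have h2 := (Complex.continuous_conj.tendsto a).comp ha
      have h3 : Filter.Tendsto (starRingEnd ℂ) (nhdsWithin y ({y | y.im ≤ 0} \ {y}))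
          (nhdsWithin ((starRingEnd ℂ) y) (H \ {(starRingEnd ℂ) y})) := by
        refine Complex.continuous_conj.continuousWithinAt.tendsto_nhdsWithin ?_
        rintro x ⟨hx, hxy⟩
        refine ⟨by simpa [hH] using hx, fun h ↦ hxy ?_⟩
        exact (starRingEnd ℂ).injective h
      refine (h2.comp h3).congr fun x ↦ ?_
      simp [slope_def_field]
    refine h1.congr_of_eventuallyEq ?_ (hGdown y hyB hy)
    filter_upwards [self_mem_nhdsWithin,
      mem_nhdsWithin_of_mem_nhds (Metric.isOpen_ball.mem_nhds hyB)] with x hx hxB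
    exact hGdown x hxB hx
  have hGd : ∀ y ∈ B, DifferentiableAt ℂ G y := by
    intro y hyB
    rcases lt_trichotomy y.im 0 with h | h | h
    · have hc : (starRingEnd ℂ) y ∈ H := by simp [hH, h.le]
      have h1 := hdown y hyB h.le _ (hall ⟨hBc y hyB, hc⟩).1.hasDerivWithinAt
      refine (h1.hasDerivAt ?_).differentiableAt
      filter_upwards [(isOpen_lt Complex.continuous_im continuous_const).mem_nhds h] with x hx
      exact le_of_lt hx
    · have hyH : y ∈ H := h.ge
      have hyc : (starRingEnd ℂ) y = y := Complex.conj_eq_iff_im.2 h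
      have hF := (hall ⟨hyB, hyH⟩).1.hasDerivWithinAt
      set a := derivWithin F H y
      -- The derivative at a real point is real, since it can be computed along the real axis, where
      -- `F` is real. Hence the derivatives of `G` from above and below agree, and they glue to a
      -- full derivative.
      have ha : (starRingEnd ℂ) a = a := by
        rw [Complex.conj_eq_iff_im]
        have hline : HasDerivAt (fun t : ℝ ↦ y + t) 1 0 := by
          simpa using (Complex.ofRealCLM.hasDerivAt (x := 0)).const_add y
        have h2 : HasDerivWithinAt (fun t : ℝ ↦ F (y + t)) (a * 1) univ 0 := by
          have hF' : HasDerivWithinAt F a H (y + (0 : ℝ)) := by simpa using hF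
          exact hF'.comp (0 : ℝ) hline.hasDerivWithinAt fun t _ ↦ by simp [hH, h]
        have h3 : HasDerivAt (fun t : ℝ ↦ F (y + t)) a 0 := by simpa using h2
        have h4 : HasDerivAt (fun t : ℝ ↦ (F (y + t)).im) a.im 0 :=
          Complex.imCLM.hasFDerivAt.comp_hasDerivAt 0 h3
        have h5 : (fun t : ℝ ↦ (F (y + t)).im) =ᶠ[nhds 0] fun _ ↦ 0 := by
          have hcont : ContinuousAt (fun t : ℝ ↦ y + (t : ℂ)) 0 := hline.continuousAt
          have h6 : ∀ᶠ t : ℝ in nhds 0, y + (t : ℂ) ∈ B :=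
            hcont.eventually_mem (Metric.isOpen_ball.mem_nhds
              (by rw [Complex.ofReal_zero, add_zero]; exact hyB))
          filter_upwards [h6] with t ht
          exact (hall ⟨ht, by simp [hH, h]⟩).2.1 (by simp [h])
        exact h4.unique ((hasDerivAt_const (0 : ℝ) (0 : ℝ)).congr_of_eventuallyEq h5)
      have h1 := hup y hyB hyH a hF
      have h2 := hdown y hyB h.le a (by rwa [hyc])
      rw [ha] at h2
      have h3 := h1.union h2
      have : H ∪ {y | y.im ≤ 0} = univ := by
        ext x
        simp [hH, le_total]
      rw [this, hasDerivWithinAt_univ] at h3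
      exact h3.differentiableAt
    · have h1 := hup y hyB h.le _ (hall ⟨hyB, h.le⟩).1.hasDerivWithinAt
      refine (h1.hasDerivAt ?_).differentiableAt
      filter_upwards [(isOpen_lt continuous_const Complex.continuous_im).mem_nhds h] with x hx
      exact le_of_lt hx
  have hBn : B ∈ nhds y₀ := Metric.ball_mem_nhds y₀ hδ
  have hy₀H : y₀ ∈ H := hy₀.ge
  have hG0 : G y₀ = F y₀ := hGup y₀ hy₀H
  have hGmax : IsLocalMax (norm ∘ G) y₀ := by
    filter_upwards [hBn] with y hy
    simp only [Function.comp_apply, hG0]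
    rcases le_total 0 y.im with h | h
    · rw [hGup y h]
      exact (hall ⟨hy, h⟩).2.2
    · rw [hGdown y hy h, RCLike.norm_conj]
      exact (hall ⟨hBc y hy, by simpa [hH] using h⟩).2.2
  have := Complex.eventually_eq_of_isLocalMax_norm
    (Filter.eventually_of_mem hBn hGd) hGmax
  filter_upwards [mem_nhdsWithin_of_mem_nhds this, self_mem_nhdsWithin] with y hy hyH
  rw [← hGup y hyH, ← hG0]
  exact hy

/-- The local maximum modulus principle in the closed half plane for holomorphic functions that are
real on the boundary. -/
theorem eventually_eq_of_isLocalMaxOn_norm_halfPlane {F : ℂ → ℂ} {y₀ : ℂ} (hy₀ : 0 ≤ y₀.im)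
    (hd : ∀ᶠ y in nhdsWithin y₀ {y | 0 ≤ y.im}, DifferentiableWithinAt ℂ F {y | 0 ≤ y.im} y)
    (hreal : ∀ᶠ y in nhdsWithin y₀ {y | 0 ≤ y.im}, y.im = 0 → (F y).im = 0)
    (hmax : ∀ᶠ y in nhdsWithin y₀ {y | 0 ≤ y.im}, ‖F y‖ ≤ ‖F y₀‖) :
    ∀ᶠ y in nhdsWithin y₀ {y | 0 ≤ y.im}, F y = F y₀ := by
  rcases hy₀.eq_or_lt with h | h
  · exact eventually_eq_of_isLocalMaxOn_norm_halfPlane_of_im_eq_zero h.symm hd hreal hmax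
  · have hopen : {y : ℂ | 0 < y.im} ∈ nhds y₀ :=
      (isOpen_lt continuous_const Complex.continuous_im).mem_nhds h
    have hn : nhdsWithin y₀ {y : ℂ | 0 ≤ y.im} = nhds y₀ :=
      nhdsWithin_eq_nhds.2 (Filter.mem_of_superset hopen fun y (hy : 0 < y.im) ↦ hy.le)
    rw [hn] at hd hmax ⊢
    refine Complex.eventually_eq_of_isLocalMax_norm ?_ hmax
    filter_upwards [hd, eventually_mem_nhds_iff.2 hopen] with y hy hyn
    exact hy.differentiableAt (Filter.mem_of_superset hyn fun y (hy : 0 < y.im) ↦ hy.le)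

/-- A maximum principle on a compact connected space: a function with the local maximum property
on an open set `O` other than the whole space attains, on a compact neighbourhood, no larger values
in `O` than outside `O`. -/
theorem exists_le_of_local_maximum {X : Type*} [TopologicalSpace X] [ConnectedSpace X] [T2Space X]
    {V O : Set X} (hV : IsCompact V) (hO : IsOpen O) (hOV : O ⊆ V) (hne : O ≠ univ) {f : X → ℝ}
    (hf : ContinuousOn f V)
    (hloc : ∀ p ∈ O, (∀ᶠ q in nhds p, f q ≤ f p) → ∀ᶠ q in nhds p, f q = f p)
    {p₀ : X} (hp₀ : p₀ ∈ O) : ∃ q ∈ V \ O, f p₀ ≤ f q := by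
  obtain ⟨q, hqV, hq⟩ := hV.exists_isMaxOn ⟨p₀, hOV hp₀⟩ hf
  by_contra! hcon
  have hlt : ∀ p ∈ V \ O, f p < f q := fun p hp ↦ (hcon p hp).trans_le (hq (hOV hp₀))
  have hqO : q ∈ O := by
    by_contra h
    exact lt_irrefl _ (hlt q ⟨hqV, h⟩)
  -- If the conclusion fails, the set where the maximum over `V` is attained lies in `O`. It is
  -- closed, and open by the local maximum property, so it is the whole connected space, against `O
  -- ≠ univ`.
  set Z : Set X := V ∩ f ⁻¹' {f q} with hZ
  have hZO : Z ⊆ O := fun p hp ↦ by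
    by_contra h
    exact (hlt p ⟨hp.1, h⟩).ne hp.2
  have hZc : IsClosed Z := hf.preimage_isClosed_of_isClosed hV.isClosed isClosed_singleton
  have hZo : IsOpen Z := by
    rw [isOpen_iff_mem_nhds]
    intro p hp
    have hpq : f p = f q := hp.2
    have hVn : ∀ᶠ x in nhds p, x ∈ V :=
      Filter.mem_of_superset (hO.mem_nhds (hZO hp)) hOV
    have h1 := hloc p (hZO hp) (hVn.mono fun x hx ↦ hpq ▸ hq hx)
    filter_upwards [h1, hVn] with x hx hxV
    exact ⟨hxV, hx.trans hpq⟩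
  have hZu : Z = univ := IsClopen.eq_univ ⟨hZc, hZo⟩ ⟨q, hqV, rfl⟩
  exact hne (eq_univ_of_subset hZO hZu)

/-! ### Symplectic balls as local diffeomorphisms -/

theorem stdForm_I_smul {n : ℕ} (v : CSpace n) : stdForm n v (Complex.I • v) = ‖v‖ ^ 2 := by
  rw [EuclideanSpace.norm_sq_eq]
  refine Finset.sum_congr rfl fun j _ ↦ ?_
  rw [← Complex.normSq_eq_norm_sq, Complex.normSq_apply]
  simp

section Ball

variable {n : ℕ} {M : Type*} [TopologicalSpace M] [ChartedSpace (RSpace n) M]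
  {Ω : ∀ x : M, TangentSpace (𝓡 (2 * n)) x →L[ℝ] TangentSpace (𝓡 (2 * n)) x →L[ℝ] ℝ}
  {R : ℝ} {e : CSpace n → M}

/-- A kernel vector `v` would satisfy `‖v‖² = ω₀(v, i v) = 0`, because the derivative preserves the
forms. -/
theorem IsSymplecticBall.injective_ballDeriv (h : IsSymplecticBall Ω R e) {x : CSpace n}
    (hx : x ∈ Metric.closedBall (0 : CSpace n) R) : Function.Injective (ballDeriv R e x) := by
  rw [injective_iff_map_eq_zero]
  intro v hv
  have h1 := h.symplectic x hx v (Complex.I • v)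
  rw [hv, stdForm_I_smul] at h1
  simpa using h1.symm

theorem ballDeriv_eq_mfderiv {x : CSpace n} (hx : x ∈ Metric.ball (0 : CSpace n) R) :
    ballDeriv R e x = mfderiv 𝓘(ℝ, CSpace n) (𝓡 (2 * n)) e x :=
  mfderivWithin_of_mem_nhds
    (Filter.mem_of_superset (Metric.isOpen_ball.mem_nhds hx) Metric.ball_subset_closedBall)

theorem IsSymplecticBall.contMDiffAt (h : IsSymplecticBall Ω R e) {x : CSpace n}
    (hx : x ∈ Metric.ball (0 : CSpace n) R) : ContMDiffAt 𝓘(ℝ, CSpace n) (𝓡 (2 * n)) ∞ e x :=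
  h.smooth.contMDiffAt
    (Filter.mem_of_superset (Metric.isOpen_ball.mem_nhds hx) Metric.ball_subset_closedBall)

theorem IsSymplecticBall.exists_hasStrictFDerivAt (h : IsSymplecticBall Ω R e) {x : CSpace n}
    (hx : x ∈ Metric.ball (0 : CSpace n) R) :
    ∃ D : CSpace n ≃L[ℝ] RSpace n,
      HasStrictFDerivAt (extChartAt (𝓡 (2 * n)) (e x) ∘ e) (D : CSpace n →L[ℝ] RSpace n) x := by
  set ψ := extChartAt (𝓡 (2 * n)) (e x) ∘ e with hψ
  have hs : ContDiffAt ℝ ∞ ψ x := by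
    rw [← contMDiffAt_iff_contDiffAt]
    exact (contMDiffAt_iff_target.1 (h.contMDiffAt hx)).2
  have hd : HasStrictFDerivAt ψ (fderiv ℝ ψ x) x := hs.hasStrictFDerivAt (by simp)
  have hmd : mfderiv 𝓘(ℝ, CSpace n) (𝓡 (2 * n)) e x = fderiv ℝ ψ x := by
    have h1 := ((h.contMDiffAt hx).mdifferentiableAt (by simp)).hasMFDerivAt.2
    simp only [mfld_simps] at h1
    have huniq : ∀ m : CSpace n →L[ℝ] RSpace n, HasFDerivWithinAt ψ m univ x →
        m = fderiv ℝ ψ x := fun m hm ↦ (hasFDerivWithinAt_univ.1 hm).unique hd.hasFDerivAt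
    exact huniq _ h1
  have hinj : Function.Injective (fderiv ℝ ψ x) := by
    have := h.injective_ballDeriv (Metric.ball_subset_closedBall hx)
    rw [ballDeriv_eq_mfderiv hx, hmd] at this
    exact this
  have hrank : Module.finrank ℝ (CSpace n) = Module.finrank ℝ (RSpace n) := by
    rw [finrank_real_of_complex]
    simp
  set D := (LinearEquiv.ofInjectiveOfFinrankEq (fderiv ℝ ψ x : CSpace n →ₗ[ℝ] RSpace n) hinj
    hrank).toContinuousLinearEquiv with hD
  refine ⟨D, ?_⟩
  have : (D : CSpace n →L[ℝ] RSpace n) = fderiv ℝ ψ x := by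
    refine ContinuousLinearMap.ext fun v ↦ ?_
    simp only [hD]
    rfl
  rwa [this]

/-- Inverse function theorem in a chart: an injective derivative between spaces of equal dimension
is invertible. Openness of `e` is what makes `e⁻¹` continuous on the image of the open ball. -/
theorem IsSymplecticBall.map_nhds_eq (h : IsSymplecticBall Ω R e) {x : CSpace n}
    (hx : x ∈ Metric.ball (0 : CSpace n) R) : Filter.map e (nhds x) = nhds (e x) := by
  obtain ⟨D, hD⟩ := h.exists_hasStrictFDerivAt hx
  have h1 := hD.map_nhds_eq_of_equiv
  refine le_antisymm (h.contMDiffAt hx).continuousAt ?_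
  intro s hs
  have h2 : e ⁻¹' s ∩ e ⁻¹' (extChartAt (𝓡 (2 * n)) (e x)).source ∈ nhds x :=
    Filter.inter_mem hs ((h.contMDiffAt hx).continuousAt (extChartAt_source_mem_nhds _))
  have h3 := Filter.image_mem_map (m := extChartAt (𝓡 (2 * n)) (e x) ∘ e) h2
  rw [h1] at h3
  have h4 := (continuousAt_extChartAt (I := 𝓡 (2 * n)) (e x)).preimage_mem_nhds h3
  filter_upwards [h4, extChartAt_source_mem_nhds (I := 𝓡 (2 * n)) (e x)] with p hp hps
  obtain ⟨y, ⟨hys, hysrc⟩, hy⟩ := hp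
  have := (extChartAt (𝓡 (2 * n)) (e x)).injOn hysrc hps hy
  exact this ▸ hys

theorem IsSymplecticBall.isOpen_image (h : IsSymplecticBall Ω R e) {s : Set (CSpace n)}
    (hs : IsOpen s) (hsR : s ⊆ Metric.ball (0 : CSpace n) R) : IsOpen (e '' s) := by
  rw [isOpen_iff_mem_nhds]
  rintro _ ⟨x, hx, rfl⟩
  rw [← h.map_nhds_eq (hsR hx)]
  exact Filter.image_mem_map (hs.mem_nhds hx)

/-- If `W = e ∘ U` near a point, then `U` is differentiable where `W` is, and the chain rule
holds. -/
theorem IsSymplecticBall.differentiableWithinAt_lift [IsManifold (𝓡 (2 * n)) ∞ M]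
    (h : IsSymplecticBall Ω R e) {W : ℂ → M} {U : ℂ → CSpace n} {s : Set ℂ} {y : ℂ}
    (hys : y ∈ s) (hs : UniqueDiffWithinAt ℝ s y)
    (hU : ContinuousWithinAt U s y) (hUy : U y ∈ Metric.ball (0 : CSpace n) R)
    (hWU : ∀ᶠ x in nhdsWithin y s, W x = e (U x))
    (hW : MDifferentiableWithinAt 𝓘(ℝ, ℂ) (𝓡 (2 * n)) W s y) :
    DifferentiableWithinAt ℝ U s y ∧
      ∀ v : ℂ, (mfderivWithin 𝓘(ℝ, ℂ) (𝓡 (2 * n)) W s y v : RSpace n)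
        = ballDeriv R e (U y) (fderivWithin ℝ U s y v) := by
  have hWy : W y = e (U y) := hWU.self_of_nhdsWithin hys
  obtain ⟨D, hD⟩ := h.exists_hasStrictFDerivAt hUy
  have hdiff : DifferentiableWithinAt ℝ U s y := by
    have h1 : MDifferentiableWithinAt 𝓘(ℝ, ℂ) 𝓘(ℝ, RSpace n)
        (extChartAt (𝓡 (2 * n)) (W y) ∘ W) s y :=
      (mdifferentiableWithinAt_iff_target.1 hW).2
    rw [mdifferentiableWithinAt_iff_differentiableWithinAt, hWy] at h1
    have h2 : DifferentiableAt ℝ (hD.localInverse _ _ _)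
        ((extChartAt (𝓡 (2 * n)) (e (U y)) ∘ W) y) := by
      have := hD.to_localInverse.hasFDerivAt.differentiableAt
      simpa [hWy] using this
    -- Near `y`, `U` is the local inverse of `e`, read in a chart of `M`, composed with `W` in that
    -- chart.
    have h3 := h2.comp_differentiableWithinAt y h1
    refine h3.congr_of_eventuallyEq ?_ ?_
    · filter_upwards [hU.eventually hD.eventually_left_inverse, hWU] with x hx hx2
      simp only [Function.comp_apply] at hx ⊢
      rw [hx2, hx]
    · have := hD.eventually_left_inverse.self_of_nhds
      simp only [Function.comp_apply] at this ⊢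
      rw [hWy, this]
  refine ⟨hdiff, fun v ↦ ?_⟩
  have he : MDifferentiableAt 𝓘(ℝ, CSpace n) (𝓡 (2 * n)) e (U y) :=
    (h.contMDiffAt hUy).mdifferentiableAt (by simp)
  have h5 : mfderivWithin 𝓘(ℝ, ℂ) (𝓡 (2 * n)) W s y
      = mfderivWithin 𝓘(ℝ, ℂ) (𝓡 (2 * n)) (e ∘ U) s y :=
    Filter.EventuallyEq.mfderivWithin_eq hWU hWy
  have h6 := mfderiv_comp_mfderivWithin y he hdiff.mdifferentiableWithinAt
    hs.uniqueMDiffWithinAt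
  rw [ballDeriv_eq_mfderiv hUy, h5, h6, mfderivWithin_eq_fderivWithin]
  rfl

end Ball

/-! ### Boundary points in charts of the surface -/

section Surface

variable {S : Type*} [TopologicalSpace S] [ChartedSpace ClosedHalfPlane S]

theorem isManifold_halfPlaneℝ [IsManifold halfPlaneℂ ω S] : IsManifold halfPlaneℝ ∞ S := by
  refine isManifold_of_contDiffOn _ _ _ fun f f' hf hf' ↦ ?_
  have h := (contDiffGroupoid ω halfPlaneℂ).compatible hf hf'
  have h1 : ContDiffOn ℂ ω (halfPlaneℂ ∘ f.symm ≫ₕ f' ∘ halfPlaneℂ.symm)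
    (halfPlaneℂ.symm ⁻¹' (f.symm ≫ₕ f').source ∩ range halfPlaneℂ) := h.1
  exact (h1.restrict_scalars ℝ).of_le le_top

theorem range_halfPlaneℝ : range halfPlaneℝ = {z : ℂ | 0 ≤ z.im} := range_closedHalfPlane

/-- Boundary points are defined by the preferred chart at `p`; smooth transition maps allow any
chart `c` around `p` instead. -/
theorem mem_boundary_iff_im_eq_zero [IsManifold halfPlaneℂ ω S] {c p : S}
    (hp : p ∈ (chartAt ClosedHalfPlane c).source) :
    p ∈ halfPlaneℝ.boundary S ↔ (extChartAt halfPlaneℝ c p).im = 0 := by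
  have := isManifold_halfPlaneℝ (S := S)
  have hmem : extChartAt halfPlaneℝ c p ∈ (extChartAt halfPlaneℝ c).target :=
    (extChartAt halfPlaneℝ c).map_source (by rwa [extChartAt_source])
  have hnonneg : 0 ≤ (extChartAt halfPlaneℝ c p).im := by
    have := extChartAt_target_subset_range (I := halfPlaneℝ) c hmem
    rwa [range_halfPlaneℝ] at this
  have hint : halfPlaneℝ.IsInteriorPoint p ↔ 0 < (extChartAt halfPlaneℝ c p).im := by
    rw [halfPlaneℝ.isInteriorPoint_iff_of_mem_atlas (n := ∞) (by simp)
      (chart_mem_atlas ClosedHalfPlane c) hp]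
    constructor
    · intro h
      have h1 := interior_mono (extChartAt_target_subset_range (I := halfPlaneℝ) c) h
      rw [range_halfPlaneℝ, Complex.interior_setOfPred_le_im] at h1
      exact h1
    · intro h
      refine (chartAt ClosedHalfPlane c).mem_interior_extend_target
        ((chartAt ClosedHalfPlane c).map_source hp) ?_
      rw [range_halfPlaneℝ, Complex.interior_setOfPred_le_im]
      exact h
  change halfPlaneℝ.IsBoundaryPoint p ↔ _
  rw [halfPlaneℝ.isBoundaryPoint_iff_not_isInteriorPoint, hint, not_lt]
  exact ⟨fun h ↦ le_antisymm h hnonneg, fun h ↦ h.le⟩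

end Surface

/-! ### The curve in ball coordinates -/

section Curve

/-- The curve `w` in the coordinates of `ℂⁿ` given by the ball `e`. -/
noncomputable def ballCoord {n : ℕ} {M S : Type*} (R : ℝ) (e : CSpace n → M) (w : S → M)
    (s : S) : CSpace n :=
  -- Where `w s` is outside the image of the closed ball this is an arbitrary value; only points
  -- over that image are ever considered.
  Function.invFunOn e (Metric.closedBall 0 R) (w s)

theorem apply_ballCoord {n : ℕ} {M S : Type*} {R : ℝ} {e : CSpace n → M} {w : S → M}
    {s : S} (hs : w s ∈ e '' Metric.closedBall 0 R) :
    e (ballCoord R e w s) = w s :=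
  Function.invFunOn_eq hs

variable {n : ℕ} {M : Type*} [TopologicalSpace M] [ChartedSpace (RSpace n) M]
  {Ω : ∀ x : M, TangentSpace (𝓡 (2 * n)) x →L[ℝ] TangentSpace (𝓡 (2 * n)) x →L[ℝ] ℝ}
  {J : ∀ x : M, TangentSpace (𝓡 (2 * n)) x →L[ℝ] TangentSpace (𝓡 (2 * n)) x}
  {U L : Set M} {R : ℝ} {e : CSpace n → M}
  {S : Type*} {bdMinus bdPlus : Set S} {w : S → M}

theorem ballCoord_mem (h : IsSymplecticBall Ω R e) {D : Set (CSpace n)}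
    (hr : D ⊆ Metric.closedBall 0 R) {s : S} (hs : w s ∈ e '' D) :
    ballCoord R e w s ∈ D := by
  obtain ⟨x, hx, hxs⟩ := hs
  have : ballCoord R e w s = x := by
    rw [ballCoord, ← hxs]
    exact h.injOn.leftInvOn_invFunOn (hr hx)
  rwa [this]

theorem ballCoord_mem_iff (h : IsSymplecticBall Ω R e) {D : Set (CSpace n)}
    (hr : D ⊆ Metric.closedBall 0 R) {s : S} (hs : w s ∈ e '' Metric.closedBall 0 R) :
    ballCoord R e w s ∈ D ↔ w s ∈ e '' D :=
  ⟨fun hm ↦ ⟨_, hm, apply_ballCoord hs⟩, fun hm ↦ ballCoord_mem h hr hm⟩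

variable [TopologicalSpace S]

theorem continuousAt_ballCoord (h : IsSymplecticBall Ω R e) (hw : Continuous w) {s : S}
    (hs : w s ∈ e '' Metric.ball 0 R) : ContinuousAt (ballCoord R e w) s := by
  obtain ⟨x, hx, hxs⟩ := hs
  have h1 : ballCoord R e w s = x := by
    rw [ballCoord, ← hxs]
    exact h.injOn.leftInvOn_invFunOn (Metric.ball_subset_closedBall hx)
  intro N hN
  rw [h1] at hN
  rw [Filter.mem_map]
  have h2 : e '' (N ∩ Metric.ball 0 R) ∈ nhds (w s) := by
    rw [← hxs, ← h.map_nhds_eq hx]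
    exact Filter.image_mem_map (Filter.inter_mem hN (Metric.isOpen_ball.mem_nhds hx))
  filter_upwards [hw.continuousAt.preimage_mem_nhds h2] with t ht
  exact (ballCoord_mem h (inter_subset_right.trans Metric.ball_subset_closedBall) ht).1

theorem isOpen_preimage_ball (h : IsSymplecticBall Ω R e) (hw : Continuous w) {r : ℝ}
    (hr : r ≤ R) : IsOpen (w ⁻¹' (e '' Metric.ball 0 r)) :=
  (h.isOpen_image Metric.isOpen_ball (Metric.ball_subset_ball hr)).preimage hw

theorem isCompact_image_closedBall (h : IsSymplecticBall Ω R e) {r : ℝ} (hr : r ≤ R) :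
    IsCompact (e '' Metric.closedBall 0 r) :=
  (isCompact_closedBall 0 r).image_of_continuousOn
    (h.smooth.continuousOn.mono (Metric.closedBall_subset_closedBall hr))

variable [ChartedSpace ClosedHalfPlane S]

/-- In a holomorphic chart, `ballCoord` is holomorphic up to the boundary, and the area density of
`w` is the squared norm of its derivative. -/
theorem exists_hasDerivWithinAt_ballCoord [IsManifold (𝓡 (2 * n)) ∞ M] [T2Space S]
    [IsManifold halfPlaneℂ ω S] (he : IsAdaptedPair Ω U L R e J)
    (hw : IsJHolomorphicCurve J bdMinus bdPlus w)
    (hadapted : IsProperlyAdapted L R e bdMinus bdPlus w) {c : S} {y : ℂ}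
    (hy : y ∈ (extChartAt halfPlaneℝ c).target)
    (hyR : inChart w c y ∈ e '' Metric.ball 0 R) :
    ∃ a : CSpace n,
      HasDerivWithinAt (fun x ↦ ballCoord R e w ((extChartAt halfPlaneℝ c).symm x)) a
        {x | 0 ≤ x.im} y ∧
      Ω (inChart w c y) (chartDeriv w c y 1) (chartDeriv w c y Complex.I) = ‖a‖ ^ 2 := by
  have := isManifold_halfPlaneℝ (S := S)
  set s : Set ℂ := {x | 0 ≤ x.im} with hs
  set p := (extChartAt halfPlaneℝ c).symm y with hp
  have hys : y ∈ s := by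
    have := extChartAt_target_subset_range (I := halfPlaneℝ) c hy
    rwa [range_halfPlaneℝ] at this
  -- Corner points lie on `∂₊S`, whose image misses the open ball, so over the open ball the curve
  -- is smooth throughout.
  have hcorner : p ∉ bdMinus ∩ bdPlus := fun hc ↦
    hadapted.plus.le_bot ⟨mem_image_of_mem w hc.2, hyR⟩
  have htn : (extChartAt halfPlaneℝ c).target ∈ nhdsWithin y s := by
    have := extChartAt_target_mem_nhdsWithin_of_mem (I := halfPlaneℝ) hy
    rwa [range_halfPlaneℝ] at this
  have hsymm : ContMDiffWithinAt 𝓘(ℝ, ℂ) halfPlaneℝ ∞ (extChartAt halfPlaneℝ c).symm s y :=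
    (contMDiffOn_extChartAt_symm (I := halfPlaneℝ) c y hy).mono_of_mem_nhdsWithin htn
  have hwp : ContMDiffAt halfPlaneℝ (𝓡 (2 * n)) ∞ w p :=
    hw.smooth.contMDiffAt (hw.finite_inter.isClosed.isOpen_compl.mem_nhds hcorner)
  have hWd : MDifferentiableWithinAt 𝓘(ℝ, ℂ) (𝓡 (2 * n)) (inChart w c) s y :=
    (hwp.comp_contMDiffWithinAt y hsymm).mdifferentiableWithinAt (by simp)
  set u : ℂ → CSpace n := fun x ↦ ballCoord R e w ((extChartAt halfPlaneℝ c).symm x) with hu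
  have huc : ContinuousWithinAt u s y :=
    (continuousAt_ballCoord he.ball hw.continuous hyR).comp_continuousWithinAt
      hsymm.continuousWithinAt
  have huy : u y ∈ Metric.ball (0 : CSpace n) R :=
    ballCoord_mem he.ball Metric.ball_subset_closedBall hyR
  have hWu : ∀ᶠ x in nhdsWithin y s, inChart w c x = e (u x) := by
    have h1 : w ⁻¹' (e '' Metric.ball 0 R) ∈ nhds p :=
      (isOpen_preimage_ball he.ball hw.continuous le_rfl).mem_nhds hyR
    filter_upwards [hsymm.continuousWithinAt.preimage_mem_nhdsWithin h1] with x hx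
    exact (apply_ballCoord (image_mono Metric.ball_subset_closedBall hx)).symm
  have hsu : UniqueDiffWithinAt ℝ s y := by
    have := halfPlaneℝ.uniqueDiffOn
    rw [range_halfPlaneℝ] at this
    exact this y hys
  obtain ⟨hud, hchain⟩ := he.ball.differentiableWithinAt_lift hys hsu huc huy hWu hWd
  set D := fderivWithin ℝ u s y with hD
  have hchart : ∀ v : ℂ, (chartDeriv w c y v : RSpace n) = ballDeriv R e (u y) (D v) := by
    intro v
    rw [← hchain v, chartDeriv, range_halfPlaneℝ]
    rfl
  have hWy : inChart w c y = e (u y) := hWu.self_of_nhdsWithin hys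
  have hub := Metric.ball_subset_closedBall huy
  -- Holomorphy with respect to `J` becomes complex linearity, as `de` is injective and intertwines
  -- `i` with `J`.
  have hDI : ∀ v : ℂ, D (Complex.I * v) = Complex.I • D v := by
    intro v
    apply he.ball.injective_ballDeriv hub
    have h1 := hw.holomorphic c y hy hcorner v
    have h2 : (J (inChart w c y) (chartDeriv w c y v) : RSpace n)
        = J (e (u y)) (ballDeriv R e (u y) (D v)) := by
      -- The two base points are only propositionally equal; every tangent space unfolds to `RSpace
      -- n`, so the equality can be substituted there.
      have h3 : ∀ q : M, q = e (u y) → ∀ a : RSpace n, ∀ b : RSpace n, a = b →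
          (J q a : RSpace n) = J (e (u y)) b := by
        rintro _ rfl _ _ rfl
        rfl
      exact h3 _ hWy _ _ (hchart v)
    have h4 : (ballDeriv R e (u y) (D (Complex.I * v)) : RSpace n)
        = ballDeriv R e (u y) (Complex.I • D v) := by
      rw [← he.standard _ hub (D v), ← h2, ← h1, hchart]
    exact h4
  set A : ℂ →L[ℂ] CSpace n := ContinuousLinearMap.toSpanSingleton ℂ (D 1) with hA
  have hAD : A.restrictScalars ℝ = D := by
    ext v : 1
    have h1 : v = v.re • (1 : ℂ) + v.im • (Complex.I * 1) := by
      simp [Complex.re_add_im]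
    rw [h1, map_add, map_add, map_smul, map_smul, map_smul, map_smul, hDI]
    simp [hA]
  refine ⟨D 1, ?_, ?_⟩
  · have h1 : HasFDerivWithinAt u (A.restrictScalars ℝ) s y := hAD ▸ hud.hasFDerivWithinAt
    have h2 : HasFDerivWithinAt u A s y := HasFDerivWithinAt.of_restrictScalars ℝ h1 rfl
    simpa [hA] using h2.hasDerivWithinAt
  · have h3 : ∀ q : M, q = e (u y) → ∀ a a' b b' : RSpace n, a = a' → b = b' →
        (Ω q a b : ℝ) = Ω (e (u y)) a' b' := by
      rintro _ rfl _ _ _ _ rfl rfl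
      rfl
    rw [h3 _ hWy _ _ _ _ (hchart 1) (hchart Complex.I), he.ball.symplectic _ hub]
    have h4 : D Complex.I = Complex.I • D 1 := by simpa using hDI 1
    rw [h4, stdForm_I_smul]

end Curve

/-- The local maximum modulus principle on a Riemann surface with boundary, for holomorphic
functions that are real on the boundary. -/
theorem eventually_eq_of_eventually_norm_le {S : Type*} [TopologicalSpace S]
    [ChartedSpace ClosedHalfPlane S] [IsManifold halfPlaneℂ ω S] {F : S → ℂ} {q : S}
    (hd : ∀ᶠ p in nhds q, DifferentiableWithinAt ℂ (F ∘ (extChartAt halfPlaneℝ q).symm)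
      {y | 0 ≤ y.im} (extChartAt halfPlaneℝ q p))
    (hreal : ∀ᶠ p in nhds q, p ∈ halfPlaneℝ.boundary S → (F p).im = 0)
    (hmax : ∀ᶠ p in nhds q, ‖F p‖ ≤ ‖F q‖) : ∀ᶠ p in nhds q, F p = F q := by
  set φ := extChartAt halfPlaneℝ q with hφ
  set H : Set ℂ := {y | 0 ≤ y.im} with hH
  have hr : range halfPlaneℝ = H := range_halfPlaneℝ
  have hq : φ.symm (φ q) = q := extChartAt_to_inv q
  have hsymm : Filter.Tendsto φ.symm (nhdsWithin (φ q) H) (nhds q) := by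
    have h1 : ContinuousAt φ.symm (φ q) := continuousAt_extChartAt_symm q
    have h2 : Filter.Tendsto φ.symm (nhds (φ q)) (nhds (φ.symm (φ q))) := h1
    rw [hq] at h2
    exact h2.mono_left nhdsWithin_le_nhds
  have htarget : ∀ᶠ y in nhdsWithin (φ q) H, y ∈ φ.target := by
    rw [← hr]
    exact extChartAt_target_mem_nhdsWithin q
  have hmem : ∀ᶠ p in nhds q, p ∈ φ.source := extChartAt_source_mem_nhds q
  have hmapsH : ∀ p ∈ φ.source, φ p ∈ H := fun p hp ↦
    hr ▸ extChartAt_target_subset_range q (φ.map_source hp)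
  have hφt : Filter.Tendsto φ (nhds q) (nhdsWithin (φ q) H) :=
    tendsto_nhdsWithin_iff.2 ⟨continuousAt_extChartAt q, hmem.mono hmapsH⟩
  have key := eventually_eq_of_isLocalMaxOn_norm_halfPlane (F := F ∘ φ.symm) (y₀ := φ q)
    (hmapsH q (mem_extChartAt_source q)) ?_ ?_ ?_
  · filter_upwards [hφt.eventually key, hmem] with p hp hps
    simpa [φ.left_inv hps, hq] using hp
  · filter_upwards [hsymm.eventually hd, htarget] with y hy hyt
    rwa [φ.right_inv hyt] at hy
  · filter_upwards [hsymm.eventually hreal, htarget] with y hy hyt hy0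
    refine hy ?_
    have hs : φ.symm y ∈ (chartAt ClosedHalfPlane q).source := by
      rw [← extChartAt_source halfPlaneℝ]
      exact φ.map_target hyt
    rw [mem_boundary_iff_im_eq_zero hs, ← hφ, φ.right_inv hyt]
    exact hy0
  · filter_upwards [hsymm.eventually hmax] with y hy
    simpa [hq] using hy

/-! ### Alexander's argument on the curve -/

section Curve

variable {n : ℕ} {M : Type*} [TopologicalSpace M] [ChartedSpace (RSpace n) M]
  [IsManifold (𝓡 (2 * n)) ∞ M]
  {Ω : ∀ x : M, TangentSpace (𝓡 (2 * n)) x →L[ℝ] TangentSpace (𝓡 (2 * n)) x →L[ℝ] ℝ}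
  {J : ∀ x : M, TangentSpace (𝓡 (2 * n)) x →L[ℝ] TangentSpace (𝓡 (2 * n)) x}
  {U L : Set M} {R : ℝ} {e : CSpace n → M}
  {S : Type*} {bdMinus bdPlus : Set S} {w : S → M}
  [TopologicalSpace S]

theorem continuousOn_ballCoord_apply (he : IsAdaptedPair Ω U L R e J) (hw : Continuous w)
    (j : Fin n) :
    ContinuousOn (fun p ↦ ballCoord R e w p j) (w ⁻¹' (e '' Metric.ball 0 R)) := fun _ hp ↦
  ((EuclideanSpace.proj j : CSpace n →L[ℂ] ℂ).continuous.continuousAt.comp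
    (continuousAt_ballCoord he.ball hw hp)).continuousWithinAt

variable [ChartedSpace ClosedHalfPlane S]

/-- Over the open ball a boundary point cannot be on `∂₊S`, so it is mapped to `L`, which is `ℝⁿ` in
the coordinates of the ball. -/
theorem im_ballCoord_eq_zero (he : IsAdaptedPair Ω U L R e J)
    (hw : IsJHolomorphicCurve J bdMinus bdPlus w)
    (hadapted : IsProperlyAdapted L R e bdMinus bdPlus w) {p : S}
    (hp : w p ∈ e '' Metric.ball 0 R) (hpb : p ∈ halfPlaneℝ.boundary S) (j : Fin n) :
    (ballCoord R e w p j).im = 0 := by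
  have hp' := image_mono Metric.ball_subset_closedBall hp
  rw [← hw.boundary_eq] at hpb
  have hpm : p ∈ bdMinus :=
    hpb.resolve_right fun h ↦ hadapted.plus.le_bot ⟨mem_image_of_mem w h, hp⟩
  refine (he.mem_iff _ (ballCoord_mem he.ball subset_rfl hp')).1 ?_ j
  rw [apply_ballCoord hp']
  exact hadapted.minus (mem_image_of_mem w hpm)

variable [T2Space S] [IsManifold halfPlaneℂ ω S]

/-- The derivatives of the components of `ballCoord` in a chart. -/
theorem exists_hasDerivWithinAt_ballCoord_apply (he : IsAdaptedPair Ω U L R e J)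
    (hw : IsJHolomorphicCurve J bdMinus bdPlus w)
    (hadapted : IsProperlyAdapted L R e bdMinus bdPlus w) {c : S} {y : ℂ}
    (hy : y ∈ (extChartAt halfPlaneℝ c).target)
    (hyR : inChart w c y ∈ e '' Metric.ball 0 R) :
    ∃ a : CSpace n,
      (∀ j, HasDerivWithinAt (fun x ↦ ballCoord R e w ((extChartAt halfPlaneℝ c).symm x) j) (a j)
        {x | 0 ≤ x.im} y) ∧
      Ω (inChart w c y) (chartDeriv w c y 1) (chartDeriv w c y Complex.I) = ∑ j, ‖a j‖ ^ 2 := by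
  obtain ⟨a, ha, hΩ⟩ := exists_hasDerivWithinAt_ballCoord he hw hadapted hy hyR
  refine ⟨a, fun j ↦ ?_, by rw [hΩ, EuclideanSpace.norm_sq_eq]⟩
  exact (EuclideanSpace.proj j : CSpace n →L[ℂ] ℂ).hasFDerivAt.comp_hasDerivWithinAt
    y ha

/-- A local maximum principle for functions of the coordinates `ballCoord` along the curve. -/
theorem eventually_eq_comp_ballCoord (he : IsAdaptedPair Ω U L R e J)
    (hw : IsJHolomorphicCurve J bdMinus bdPlus w)
    (hadapted : IsProperlyAdapted L R e bdMinus bdPlus w) (b : ℂ) (G : Fin n → ℂ → ℂ)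
    (O : Fin n → Set ℂ) (hO : ∀ j, IsOpen (O j)) (hG : ∀ j, DifferentiableOn ℂ (G j) (O j))
    (hb : b.im = 0) (hGreal : ∀ j x, x.im = 0 → (G j x).im = 0) {q : S}
    (hq : ∀ᶠ p in nhds q, w p ∈ e '' Metric.ball 0 R ∧ ∀ j, ballCoord R e w p j ∈ O j)
    (hmax : ∀ᶠ p in nhds q, ‖b - ∑ j, G j (ballCoord R e w p j)‖
      ≤ ‖b - ∑ j, G j (ballCoord R e w q j)‖) :
    ∀ᶠ p in nhds q, b - ∑ j, G j (ballCoord R e w p j) = b - ∑ j, G j (ballCoord R e w q j) := by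
  refine eventually_eq_of_eventually_norm_le (F := fun p ↦ b - ∑ j, G j (ballCoord R e w p j))
    ?_ ?_ hmax
  · filter_upwards [hq, extChartAt_source_mem_nhds (I := halfPlaneℝ) q] with p hp hps
    set φ := extChartAt halfPlaneℝ q with hφ
    have hpp : φ.symm (φ p) = p := φ.left_inv hps
    obtain ⟨a, ha, -⟩ := exists_hasDerivWithinAt_ballCoord_apply he hw hadapted
      (φ.map_source hps) (by rw [inChart, ← hφ, hpp]; exact hp.1)
    refine DifferentiableWithinAt.const_sub (DifferentiableWithinAt.fun_sum fun j _ ↦ ?_) b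
    refine DifferentiableAt.comp_differentiableWithinAt (φ p) (g := G j)
      (f := fun y ↦ ballCoord R e w (φ.symm y) j) ?_ (ha j).differentiableWithinAt
    simp only [hpp]
    exact (hG j).differentiableAt ((hO j).mem_nhds (hp.2 j))
  · filter_upwards [hq] with p hp hpb
    rw [Complex.sub_im, hb, Complex.im_sum, Finset.sum_eq_zero, sub_zero]
    exact fun j _ ↦ hGreal j _ (im_ballCoord_eq_zero he hw hadapted hp.1 hpb j)

/-- A properly adapted curve is not contained in the open ball. -/
theorem preimage_ball_ne_univ [CompactSpace S] [ConnectedSpace S]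
    (he : IsAdaptedPair Ω U L R e J) (hw : IsJHolomorphicCurve J bdMinus bdPlus w)
    (hadapted : IsProperlyAdapted L R e bdMinus bdPlus w) :
    w ⁻¹' (e '' Metric.ball 0 R) ≠ univ := by
  intro huniv
  have hall : ∀ p, w p ∈ e '' Metric.ball 0 R := fun p ↦ (huniv ▸ mem_univ p :)
  -- A curve inside the open ball would have coordinates holomorphic on a compact surface and real
  -- on its boundary, hence constant. This contradicts the nonzero derivative at the somewhere
  -- injective point.
  have hconst : ∀ j, ∃ k, ∀ p, ballCoord R e w p j = k := by
    intro j
    have hc : Continuous fun p ↦ ballCoord R e w p j := by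
      rw [← continuousOn_univ, ← huniv]
      exact continuousOn_ballCoord_apply he hw.continuous j
    obtain ⟨q, -, hq⟩ := isCompact_univ.exists_isMaxOn univ_nonempty hc.norm.continuousOn
    refine ⟨ballCoord R e w q j, ?_⟩
    have hclopen : IsClopen {p | ballCoord R e w p j = ballCoord R e w q j} := by
      refine ⟨isClosed_eq hc continuous_const, isOpen_iff_mem_nhds.2 fun p hp ↦ ?_⟩
      have hp : ballCoord R e w p j = ballCoord R e w q j := hp
      have hsum : ∀ x : S, ∑ i, (if i = j then ballCoord R e w x i else 0)
          = ballCoord R e w x j := by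
        intro x
        simp
      -- With `b = 0` and all `G i` zero except the identity at `i = j`, the sum is the single
      -- coordinate `u_j`.
      have := eventually_eq_comp_ballCoord he hw hadapted 0
        (fun i x ↦ if i = j then x else 0) (fun _ ↦ univ) (fun _ ↦ isOpen_univ)
        (fun i ↦ by split_ifs <;> fun_prop) (by simp)
        (fun i x hx ↦ by split_ifs <;> simp [hx]) (q := p)
        (Filter.Eventually.of_forall fun x ↦ ⟨hall x, fun _ ↦ mem_univ _⟩)
        (Filter.Eventually.of_forall fun x ↦ by
          simp only [hsum, zero_sub, norm_neg]
          rw [hp]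
          exact hq (mem_univ x))
      filter_upwards [this] with x hx
      simp only [hsum, zero_sub, neg_inj] at hx
      exact hx.trans hp
    have := hclopen.eq_univ ⟨q, rfl⟩
    exact fun p ↦ (this ▸ mem_univ p : p ∈ {p | ballCoord R e w p j = ballCoord R e w q j})
  choose k hk using hconst
  obtain ⟨z, -, -, hz⟩ := hw.somewhere_injective
  refine hz ?_
  have hwz : w = fun _ ↦ w z := by
    funext p
    rw [← apply_ballCoord (image_mono Metric.ball_subset_closedBall (hall p)),
      ← apply_ballCoord (image_mono Metric.ball_subset_closedBall (hall z))]
    congr 1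
    ext j
    rw [hk, hk]
  have h0 : ∀ v : M, mfderiv halfPlaneℝ (𝓡 (2 * n)) (fun _ : S ↦ v) z = 0 := fun v ↦ mfderiv_const
  have h1 := h0 (w z)
  have h2 : ∀ f : S → M, f = w → mfderiv halfPlaneℝ (𝓡 (2 * n)) f z = 0 →
      mfderiv halfPlaneℝ (𝓡 (2 * n)) w z = 0 := by
    rintro _ rfl h
    exact h
  exact h2 _ hwz.symm h1

/-- The areas of the coordinate projections of the part of a curve in a ball. -/
theorem pi_mul_sq_le_sum_area_projections [T2Space M] [CompactSpace S] [ConnectedSpace S]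
    (he : IsAdaptedPair Ω U L R e J) (hw : IsJHolomorphicCurve J bdMinus bdPlus w)
    (hadapted : IsProperlyAdapted L R e bdMinus bdPlus w) (hcenter : e 0 ∈ range w) {r : ℝ}
    (hr : 0 < r) (hrR : r < R) :
    Real.pi * r ^ 2 ≤ 2 * ∑ j : Fin n,
      volume.real ((fun p ↦ ballCoord R e w p j) '' (w ⁻¹' (e '' Metric.closedBall 0 r))) := by
  set V : Set S := w ⁻¹' (e '' Metric.closedBall 0 r) with hV
  set O : Set S := w ⁻¹' (e '' Metric.ball 0 r) with hO
  set P : Fin n → Set ℂ := fun j ↦ (fun p ↦ ballCoord R e w p j) '' V with hP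
  -- Symmetrising the projections lets the approximants be real on the real axis, as reflection
  -- requires.
  set K : Fin n → Set ℂ := fun j ↦ P j ∪ (starRingEnd ℂ) '' P j with hK
  have hVR : V ⊆ w ⁻¹' (e '' Metric.ball 0 R) :=
    preimage_mono (image_mono (Metric.closedBall_subset_ball hrR))
  have hVc : IsCompact V :=
    ((isCompact_image_closedBall he.ball hrR.le).isClosed.preimage hw.continuous).isCompact
  have hOV : O ⊆ V := preimage_mono (image_mono Metric.ball_subset_closedBall)
  have hOo : IsOpen O := isOpen_preimage_ball he.ball hw.continuous hrR.le
  have hOne : O ≠ univ := fun h ↦ preimage_ball_ne_univ he hw hadapted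
    (eq_univ_of_subset (hOV.trans hVR) h)
  have hPc : ∀ j, IsCompact (P j) := fun j ↦
    hVc.image_of_continuousOn ((continuousOn_ballCoord_apply he hw.continuous j).mono hVR)
  have hKc : ∀ j, IsCompact (K j) := fun j ↦
    (hPc j).union ((hPc j).image Complex.continuous_conj)
  have hKsymm : ∀ j, ∀ z ∈ K j, (starRingEnd ℂ) z ∈ K j := by
    rintro j z (hz | ⟨x, hx, rfl⟩)
    · exact Or.inr (mem_image_of_mem _ hz)
    · exact Or.inl (by simpa using hx)
  have hPK : ∀ p ∈ V, ∀ j, ballCoord R e w p j ∈ K j := fun p hp j ↦ Or.inl ⟨p, hp, rfl⟩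
  have hKvol : ∀ j, volume.real (K j) ≤ 2 * volume.real (P j) := by
    intro j
    have h1 : volume.real ((starRingEnd ℂ) '' P j) = volume.real (P j) := by
      have h2 : (starRingEnd ℂ) '' P j = (Complex.conjLIE : ℂ → ℂ) ⁻¹' P j := by
        ext z
        simp only [mem_image, mem_preimage, Complex.conjLIE_apply]
        constructor
        · rintro ⟨x, hx, rfl⟩
          simpa using hx
        · intro hz
          exact ⟨_, hz, by simp⟩
      rw [h2, measureReal_def, measureReal_def,
        Complex.conjLIE.measurePreserving.measure_preimage (hPc j).measurableSet.nullMeasurableSet]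
    have := measureReal_union_le (μ := volume) (P j) ((starRingEnd ℂ) '' P j)
    rw [h1] at this
    linarith
  refine le_of_forall_pos_le_add fun δ hδ ↦ ?_
  -- There are `n` errors `ε` to absorb; the denominator `n + 1` also covers `n = 0`.
  set ε : ℝ := δ / (n + 1) with hε
  have hεpos : 0 < ε := by positivity
  have hnε : n * ε ≤ δ := by
    rw [hε, mul_div_assoc', div_le_iff₀ (by positivity)]
    nlinarith
  choose W g hWo hKW hgd hgreal hgK using fun j ↦
    exists_differentiableOn_conj_approx (hKc j) (hKsymm j) hεpos
  -- A holomorphic substitute for `r² - ‖u‖²`, with `g j` in place of conjugation; its value at the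
  -- centre is `r²`.
  set f : S → ℂ := fun p ↦ ((r ^ 2 : ℝ) : ℂ) - ∑ j, ballCoord R e w p j * g j (ballCoord R e w p j)
    with hf
  have hfc : ContinuousOn f V := by
    refine continuousOn_const.sub (continuousOn_finsetSum _ fun j _ ↦ ?_)
    have h1 := (continuousOn_ballCoord_apply he hw.continuous j).mono hVR
    exact h1.mul ((hgd j).continuousOn.comp h1 fun p hp ↦ hKW j (hPK p hp j))
  obtain ⟨p₀, hp₀⟩ := hcenter
  have hp₀O : p₀ ∈ O := ⟨0, by simpa using hr, hp₀.symm⟩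
  obtain ⟨q, ⟨hqV, hqO⟩, hq⟩ := exists_le_of_local_maximum hVc hOo hOV hOne
    (f := fun p ↦ ‖f p‖) hfc.norm (fun p hp hmax ↦ by
      have := eventually_eq_comp_ballCoord he hw hadapted ((r ^ 2 : ℝ) : ℂ)
        (fun j x ↦ x * g j x) W hWo (fun j ↦ differentiableOn_id.mul (hgd j))
        (Complex.ofReal_im _) (fun j x hx ↦ by simp [hx, hgreal j x hx]) (q := p)
        (Filter.eventually_of_mem (hOo.mem_nhds hp) fun x hx ↦
          ⟨hVR (hOV hx), fun j ↦ hKW j (hPK x (hOV hx) j)⟩) hmax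
      exact this.mono fun x hx ↦ congrArg norm hx) hp₀O
  have hfp₀ : ‖f p₀‖ = r ^ 2 := by
    have h0 : ballCoord R e w p₀ = 0 := by
      have h1 : w p₀ ∈ e '' {0} := ⟨0, rfl, hp₀.symm⟩
      exact ballCoord_mem he.ball (by simpa using (hr.trans hrR).le) h1
    simp [hf, h0]
  have hqnorm : ‖ballCoord R e w q‖ = r := by
    have h1 := ballCoord_mem he.ball (Metric.closedBall_subset_closedBall hrR.le) hqV
    have h2 : ballCoord R e w q ∉ Metric.ball 0 r := fun h ↦ hqO <|
      (ballCoord_mem_iff he.ball ((Metric.ball_subset_ball hrR.le).trans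
        Metric.ball_subset_closedBall) (image_mono Metric.ball_subset_closedBall (hVR hqV))).1 h
    rw [mem_closedBall_zero_iff] at h1
    rw [mem_ball_zero_iff, not_lt] at h2
    exact le_antisymm h1 h2
  set u := ballCoord R e w q with hu
  have hsq : ∑ j, ‖u j‖ ^ 2 = r ^ 2 := by rw [← EuclideanSpace.norm_sq_eq, hqnorm]
  -- On the sphere `r²` is `∑ u_j conj(u_j)`, so only the approximation errors of `g j` remain.
  have hfq : f q = ∑ j, u j * ((starRingEnd ℂ) (u j) - g j (u j)) := by
    simp only [hf, mul_sub, Finset.sum_sub_distrib]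
    congr 1
    rw [← hsq]
    push_cast
    exact Finset.sum_congr rfl fun j _ ↦ (Complex.mul_conj' _).symm
  have hbound : ‖f q‖ ^ 2 ≤ r ^ 2 * ∑ j, ‖(starRingEnd ℂ) (u j) - g j (u j)‖ ^ 2 := by
    have h1 : ‖f q‖ ≤ ∑ j, ‖u j‖ * ‖(starRingEnd ℂ) (u j) - g j (u j)‖ := by
      rw [hfq]
      refine (norm_sum_le _ _).trans (le_of_eq ?_)
      simp only [norm_mul]
    have h2 := Finset.sum_mul_sq_le_sq_mul_sq Finset.univ (fun j ↦ ‖u j‖)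
      fun j ↦ ‖(starRingEnd ℂ) (u j) - g j (u j)‖
    rw [hsq] at h2
    refine le_trans ?_ h2
    gcongr
  have h3 : r ^ 2 * r ^ 2 ≤ r ^ 2 * ∑ j, ‖(starRingEnd ℂ) (u j) - g j (u j)‖ ^ 2 := by
    refine le_trans ?_ hbound
    simp only [hfp₀] at hq
    nlinarith [sq_nonneg r]
  have h4 := le_of_mul_le_mul_left h3 (by positivity)
  calc Real.pi * r ^ 2
      ≤ Real.pi * ∑ j, ‖(starRingEnd ℂ) (u j) - g j (u j)‖ ^ 2 := by gcongr
    _ = ∑ j, Real.pi * ‖(starRingEnd ℂ) (u j) - g j (u j)‖ ^ 2 := Finset.mul_sum ..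
    _ ≤ ∑ j, (2 * volume.real (P j) + ε) := Finset.sum_le_sum fun j _ ↦
        (hgK j _ (hPK q hqV j)).trans (by linarith [hKvol j])
    _ = 2 * ∑ j, volume.real (P j) + n * ε := by
        rw [Finset.sum_add_distrib, ← Finset.mul_sum]
        simp
    _ ≤ _ := by linarith

end Curve

/-! ### Comparison of the area of the curve with its projections -/

theorem det_restrictScalars_toSpanSingleton (d : ℂ) :
    ((ContinuousLinearMap.toSpanSingleton ℂ d).restrictScalars ℝ : ℂ →L[ℝ] ℂ).det = ‖d‖ ^ 2 := by
  have h : (((ContinuousLinearMap.toSpanSingleton ℂ d).restrictScalars ℝ : ℂ →L[ℝ] ℂ) : ℂ →ₗ[ℝ] ℂ)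
      = LinearMap.mulLeft ℝ d := by
    ext
    simp [mul_comm]
  rw [ContinuousLinearMap.det, h, ← Complex.normSq_eq_norm_sq, ← Algebra.norm_complex_apply]
  rfl

theorem volume_setOf_im_eq_zero : volume {z : ℂ | z.im = 0} = 0 := by
  have := Measure.addHaar_submodule (volume : Measure ℂ) (LinearMap.ker Complex.imLm) (fun h ↦ by
    have h1 : Complex.I ∈ LinearMap.ker Complex.imLm := h ▸ Submodule.mem_top
    simp at h1)
  exact this

/-- Locally injective open parts of a space can be covered, up to identifying points with the same
image, by countably many pieces with disjoint images. -/
theorem exists_seq_isCompact_cover {S X : Type*} [TopologicalSpace S] [CompactSpace S] [T2Space S]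
    [SecondCountableTopology S] [Nonempty S] (w : S → X) (C : S → Set S) (hC : ∀ c, IsOpen (C c))
    (hcC : ∀ c, c ∈ C c) {O : Set S} (hO : IsOpen O) :
    ∃ (c : ℕ → S) (B : ℕ → Set S), (∀ k, IsCompact (B k) ∧ B k ⊆ C (c k) ∩ O ∧ InjOn w (B k)) ∧
      ∀ p ∈ O, (∃ N ∈ nhds p, InjOn w N) → ∃ k, p ∈ B k := by
  set P : Set S := {p ∈ O | ∃ N ∈ nhds p, InjOn w N} with hP
  have h1 : ∀ p, ∃ B : Set S, (IsCompact B ∧ B ⊆ C p ∩ O ∧ InjOn w B) ∧ (p ∈ P → B ∈ nhds p) := by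
    intro p
    by_cases hp : p ∈ P
    · obtain ⟨hpO, N, hN, hinj⟩ := hp
      have h2 : C p ∩ O ∩ N ∈ nhds p :=
        Filter.inter_mem (((hC p).inter hO).mem_nhds ⟨hcC p, hpO⟩) hN
      obtain ⟨B, hB, hBs, hBc⟩ := local_compact_nhds h2
      exact ⟨B, ⟨hBc, hBs.trans inter_subset_left, hinj.mono (hBs.trans inter_subset_right)⟩,
        fun _ ↦ hB⟩
    · exact ⟨∅, ⟨isCompact_empty, empty_subset _, injOn_empty _⟩, fun h ↦ absurd h hp⟩
  choose B hB hBn using h1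
  obtain ⟨t, -, htc, ht⟩ := TopologicalSpace.countable_cover_nhdsWithin (f := B) (s := P)
    fun p hp ↦ mem_nhdsWithin_of_mem_nhds (hBn p hp)
  -- The extra point makes the countable index set nonempty, so that a sequence can enumerate it.
  obtain ⟨s₀⟩ := ‹Nonempty S›
  obtain ⟨c, hc⟩ := (htc.insert s₀).exists_eq_range (insert_nonempty _ _)
  refine ⟨c, fun k ↦ B (c k), fun k ↦ hB (c k), fun p hp hN ↦ ?_⟩
  obtain ⟨q, hq, hpq⟩ := mem_iUnion₂.1 (ht ⟨hp, hN⟩)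
  obtain ⟨k, rfl⟩ : q ∈ range c := hc ▸ mem_insert_of_mem _ hq
  exact ⟨k, hpq⟩

section Curve

variable {n : ℕ} {M : Type*} [TopologicalSpace M] [ChartedSpace (RSpace n) M]
  {Ω : ∀ x : M, TangentSpace (𝓡 (2 * n)) x →L[ℝ] TangentSpace (𝓡 (2 * n)) x →L[ℝ] ℝ}
  {J : ∀ x : M, TangentSpace (𝓡 (2 * n)) x →L[ℝ] TangentSpace (𝓡 (2 * n)) x}
  {U L : Set M} {R : ℝ} {e : CSpace n → M}
  {S : Type*} {bdMinus bdPlus : Set S} {w : S → M}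
  [TopologicalSpace S] [ChartedSpace ClosedHalfPlane S]

theorem curveArea_mono [MeasurableSpace S] {K K' : Set M} (h : K ⊆ K') :
    curveArea Ω w K ≤ curveArea Ω w K' :=
  iSup₂_le fun c A ↦ iSup₂_le fun hA hd ↦ le_iSup₂_of_le c A <| le_iSup₂_of_le
    (fun k ↦ ⟨(hA k).1, (hA k).2.1, (hA k).2.2.1, (hA k).2.2.2.trans h⟩) hd le_rfl

variable [IsManifold (𝓡 (2 * n)) ∞ M] [T2Space S] [IsManifold halfPlaneℂ ω S]

/-- At an interior point of the half plane, the components of `ballCoord` in a chart are complex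
differentiable. -/
theorem hasDerivAt_ballCoord_apply (he : IsAdaptedPair Ω U L R e J)
    (hw : IsJHolomorphicCurve J bdMinus bdPlus w)
    (hadapted : IsProperlyAdapted L R e bdMinus bdPlus w) {c : S} {y : ℂ}
    (hy : y ∈ (extChartAt halfPlaneℝ c).target) (hyi : 0 < y.im)
    (hyR : inChart w c y ∈ e '' Metric.ball 0 R) :
    (∀ j, DifferentiableAt ℂ
      (fun x ↦ ballCoord R e w ((extChartAt halfPlaneℝ c).symm x) j) y) ∧
    Ω (inChart w c y) (chartDeriv w c y 1) (chartDeriv w c y Complex.I)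
      = ∑ j, ‖deriv (fun x ↦ ballCoord R e w ((extChartAt halfPlaneℝ c).symm x) j) y‖ ^ 2 := by
  obtain ⟨a, ha, hΩ⟩ := exists_hasDerivWithinAt_ballCoord_apply he hw hadapted hy hyR
  have hn : {x : ℂ | 0 ≤ x.im} ∈ nhds y := by
    filter_upwards [(isOpen_lt continuous_const Complex.continuous_im).mem_nhds hyi] with x hx
    exact le_of_lt hx
  have ha' := fun j ↦ (ha j).hasDerivAt hn
  refine ⟨fun j ↦ (ha' j).differentiableAt, ?_⟩
  rw [hΩ]
  exact Finset.sum_congr rfl fun j _ ↦ by rw [(ha' j).deriv]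

/-- A curve is injective near an interior point where some coordinate has nonzero derivative. -/
theorem exists_injOn_nhds_of_deriv_ne_zero (he : IsAdaptedPair Ω U L R e J)
    (hw : IsJHolomorphicCurve J bdMinus bdPlus w)
    (hadapted : IsProperlyAdapted L R e bdMinus bdPlus w) {c p : S}
    (hp : p ∈ (chartAt ClosedHalfPlane c).source) (hpi : p ∉ halfPlaneℝ.boundary S)
    (hpR : w p ∈ e '' Metric.ball 0 R) {j : Fin n}
    (hj : deriv (fun x ↦ ballCoord R e w ((extChartAt halfPlaneℝ c).symm x) j)
      (extChartAt halfPlaneℝ c p) ≠ 0) : ∃ N ∈ nhds p, InjOn w N := by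
  set φ := extChartAt halfPlaneℝ c with hφ
  set f : ℂ → ℂ := fun x ↦ ballCoord R e w (φ.symm x) j with hf
  have hps : p ∈ φ.source := by rwa [hφ, extChartAt_source]
  have hyt : φ p ∈ φ.target := φ.map_source hps
  have hr : range halfPlaneℝ = {x : ℂ | 0 ≤ x.im} := range_halfPlaneℝ
  have hyi : 0 < (φ p).im := by
    have h0 : 0 ≤ (φ p).im := by
      have := extChartAt_target_subset_range (I := halfPlaneℝ) c hyt
      rwa [hr] at this
    refine h0.lt_of_ne fun h ↦ hpi ?_
    rw [mem_boundary_iff_im_eq_zero hp]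
    exact h.symm
  have hin : {x : ℂ | 0 < x.im} ∈ nhds (φ p) :=
    (isOpen_lt continuous_const Complex.continuous_im).mem_nhds hyi
  have htn : φ.target ∈ nhds (φ p) := by
    have h1 := extChartAt_target_mem_nhdsWithin_of_mem (I := halfPlaneℝ) hyt
    rw [hr] at h1
    have h2 : nhdsWithin (φ p) {x : ℂ | 0 ≤ x.im} = nhds (φ p) :=
      nhdsWithin_eq_nhds.2 (Filter.mem_of_superset hin fun x (hx : 0 < x.im) ↦ hx.le)
    rwa [h2] at h1
  have hsymm : ContinuousAt φ.symm (φ p) := continuousAt_extChartAt_symm'' hyt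
  have hback : φ.symm (φ p) = p := φ.left_inv hps
  have hRn : ∀ᶠ x in nhds (φ p), w (φ.symm x) ∈ e '' Metric.ball 0 R := by
    refine hsymm.eventually_mem (s := w ⁻¹' (e '' Metric.ball 0 R))
      ((isOpen_preimage_ball he.ball hw.continuous le_rfl).mem_nhds ?_)
    rw [hback]
    exact hpR
  have hd : ∀ᶠ x in nhds (φ p), DifferentiableAt ℂ f x := by
    filter_upwards [hin, htn, hRn] with x hx hxt hxR
    exact (hasDerivAt_ballCoord_apply he hw hadapted hxt hx hxR).1 j
  have hstrict : HasStrictDerivAt f (deriv f (φ p)) (φ p) :=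
    (Complex.analyticAt_iff_eventually_differentiableAt.2 hd).hasStrictDerivAt
  -- A local left inverse recovers the chart coordinate from `u_j`, and `u_j` at a point depends
  -- only on its image under `w`.
  have hinv := HasStrictDerivAt.eventually_left_inverse (hf := hstrict) (hf' := hj)
  have hN : {x | hstrict.localInverse f (deriv f (φ p)) (φ p) hj (f x) = x} ∈ nhds (φ p) := hinv
  have hφc : ContinuousAt φ p := continuousAt_extChartAt' hps
  refine ⟨φ ⁻¹' _ ∩ φ.source, Filter.inter_mem (hφc.preimage_mem_nhds hN)
    ((isOpen_extChartAt_source c).mem_nhds hps), ?_⟩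
  rintro a ⟨ha, has⟩ b ⟨hb, hbs⟩ hab
  apply φ.injOn has hbs
  have ha : hstrict.localInverse f (deriv f (φ p)) (φ p) hj (f (φ a)) = φ a := ha
  have hb : hstrict.localInverse f (deriv f (φ p)) (φ p) hj (f (φ b)) = φ b := hb
  rw [← ha, ← hb]
  congr 1
  simp only [hf, φ.left_inv has, φ.left_inv hbs, ballCoord, hab]

/-- The coordinate projections of the set where a curve is not an interior immersion are null. -/
theorem volume_image_ballCoord_eq_zero [CompactSpace S] (he : IsAdaptedPair Ω U L R e J)
    (hw : IsJHolomorphicCurve J bdMinus bdPlus w)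
    (hadapted : IsProperlyAdapted L R e bdMinus bdPlus w) (j : Fin n) :
    volume ((fun p ↦ ballCoord R e w p j) '' {p | w p ∈ e '' Metric.ball 0 R ∧
      (p ∈ (halfPlaneℝ.boundary S)ᶜ → ¬ ∃ N ∈ nhds p, InjOn w N)}) = 0 := by
  set Z : Set S := {p | w p ∈ e '' Metric.ball 0 R ∧
      (p ∈ (halfPlaneℝ.boundary S)ᶜ → ¬ ∃ N ∈ nhds p, InjOn w N)} with hZ
  obtain ⟨T, -, hT⟩ := (isCompact_univ (X := S)).elim_nhds_subcover
    (fun c ↦ (chartAt ClosedHalfPlane c).source) fun c _ ↦ chart_source_mem_nhds _ c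
  set φ := fun c : S ↦ extChartAt halfPlaneℝ c with hφ
  set f := fun (c : S) (x : ℂ) ↦ ballCoord R e w ((φ c).symm x) j with hf
  set E := fun c : S ↦ {y ∈ (φ c).target | 0 < y.im ∧ inChart w c y ∈ e '' Metric.ball 0 R ∧
    deriv (f c) y = 0} with hE
  have hE0 : ∀ c, volume (f c '' E c) = 0 := by
    intro c
    refine addHaar_image_eq_zero_of_det_fderivWithin_eq_zero volume
      (f' := fun y ↦ (ContinuousLinearMap.toSpanSingleton ℂ (deriv (f c) y)).restrictScalars ℝ)
      (fun y hy ↦ ?_) fun y hy ↦ ?_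
    · have := (hasDerivAt_ballCoord_apply he hw hadapted hy.1 hy.2.1 hy.2.2.1).1 j
      exact (this.hasDerivAt.hasFDerivAt.restrictScalars ℝ).hasFDerivWithinAt
    · rw [det_restrictScalars_toSpanSingleton, hy.2.2.2]
      simp
  -- Boundary points project into the real axis. At the other points of `Z` local injectivity fails,
  -- so `u_j' = 0` there, and Sard's theorem in equal dimensions applies in finitely many charts.
  refine measure_mono_null (t := {z : ℂ | z.im = 0} ∪ ⋃ c ∈ T, f c '' E c) ?_ ?_
  · rintro _ ⟨p, ⟨hpR, hp⟩, rfl⟩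
    by_cases hpb : p ∈ halfPlaneℝ.boundary S
    · exact Or.inl (im_ballCoord_eq_zero he hw hadapted hpR hpb j)
    · right
      obtain ⟨c, hcT, hpc⟩ := mem_iUnion₂.1 (hT (mem_univ p))
      have hps : p ∈ (φ c).source := by rwa [extChartAt_source]
      have hback : (φ c).symm (φ c p) = p := (φ c).left_inv hps
      refine mem_iUnion₂.2 ⟨c, hcT, φ c p, ⟨(φ c).map_source hps, ?_, ?_, ?_⟩, ?_⟩
      · have h0 : 0 ≤ (φ c p).im := by
          have := extChartAt_target_subset_range (I := halfPlaneℝ) c ((φ c).map_source hps)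
          rwa [range_halfPlaneℝ] at this
        refine h0.lt_of_ne fun h ↦ hpb ?_
        rw [mem_boundary_iff_im_eq_zero hpc]
        exact h.symm
      · change w ((φ c).symm (φ c p)) ∈ _
        rwa [hback]
      · by_contra hne
        exact hp hpb (exists_injOn_nhds_of_deriv_ne_zero he hw hadapted hpc hpb hpR hne)
      · simp only [hf, hback]
  · refine measure_union_null volume_setOf_im_eq_zero ?_
    exact (measure_biUnion_null_iff T.countable_toSet).2 fun c _ ↦ hE0 c

/-- The coordinate projections of a piece of a curve in a chart have total area at most the area
of the piece. -/
theorem sum_volume_image_le_lintegral (he : IsAdaptedPair Ω U L R e J)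
    (hw : IsJHolomorphicCurve J bdMinus bdPlus w)
    (hadapted : IsProperlyAdapted L R e bdMinus bdPlus w) {c : S} {A : Set S}
    (hA : A ⊆ (chartAt ClosedHalfPlane c).source) (hAb : Disjoint A (halfPlaneℝ.boundary S))
    (hAR : A ⊆ w ⁻¹' (e '' Metric.ball 0 R))
    (hAm : MeasurableSet (extChartAt halfPlaneℝ c '' A)) :
    ∑ j, volume ((fun p ↦ ballCoord R e w p j) '' A) ≤
      ∫⁻ y in extChartAt halfPlaneℝ c '' A, ENNReal.ofReal
        (Ω (inChart w c y) (chartDeriv w c y 1) (chartDeriv w c y Complex.I)) := by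
  set φ := extChartAt halfPlaneℝ c with hφ
  set f := fun (j : Fin n) (x : ℂ) ↦ ballCoord R e w (φ.symm x) j with hf
  have hAs : A ⊆ φ.source := by rwa [hφ, extChartAt_source]
  have hpt : ∀ y ∈ φ '' A, (∀ j, DifferentiableAt ℂ (f j) y) ∧
      Ω (inChart w c y) (chartDeriv w c y 1) (chartDeriv w c y Complex.I)
        = ∑ j, ‖deriv (f j) y‖ ^ 2 := by
    rintro _ ⟨p, hp, rfl⟩
    have hback : φ.symm (φ p) = p := φ.left_inv (hAs hp)
    refine hasDerivAt_ballCoord_apply he hw hadapted (φ.map_source (hAs hp)) ?_ ?_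
    · have h0 : 0 ≤ (φ p).im := by
        have := extChartAt_target_subset_range (I := halfPlaneℝ) c (φ.map_source (hAs hp))
        rwa [range_halfPlaneℝ] at this
      refine h0.lt_of_ne fun h ↦ hAb.le_bot ⟨hp, ?_⟩
      rw [mem_boundary_iff_im_eq_zero (hA hp)]
      exact h.symm
    · change w (φ.symm (φ p)) ∈ _
      rw [hback]
      exact hAR hp
  have hle : ∀ j, volume ((fun p ↦ ballCoord R e w p j) '' A)
      ≤ ∫⁻ y in φ '' A, ENNReal.ofReal (‖deriv (f j) y‖ ^ 2) := by
    intro j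
    have himage : (fun p ↦ ballCoord R e w p j) '' A = f j '' (φ '' A) := by
      rw [image_image]
      refine image_congr fun p hp ↦ ?_
      simp only [hf, φ.left_inv (hAs hp)]
    rw [himage]
    -- The area of an image is at most the integral of the Jacobian, here `‖u_j'‖²`; the projection
    -- need not be injective.
    have := addHaar_image_le_lintegral_abs_det_fderiv volume hAm (f := f j)
      (f' := fun y ↦ (ContinuousLinearMap.toSpanSingleton ℂ (deriv (f j) y)).restrictScalars ℝ)
      fun y hy ↦ (((hpt y hy).1 j).hasDerivAt.hasFDerivAt.restrictScalars ℝ).hasFDerivWithinAt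
    simpa only [det_restrictScalars_toSpanSingleton, abs_pow, abs_norm] using this
  -- Superadditivity of the lower integral suffices, so measurability of the densities is not
  -- needed.
  have hsum : ∀ s : Finset (Fin n), ∑ j ∈ s, ∫⁻ y in φ '' A, ENNReal.ofReal (‖deriv (f j) y‖ ^ 2)
      ≤ ∫⁻ y in φ '' A, ∑ j ∈ s, ENNReal.ofReal (‖deriv (f j) y‖ ^ 2) := by
    intro s
    induction s using Finset.cons_induction with
    | empty => simp
    | cons a s ha ih =>
      simp only [Finset.sum_cons]
      exact (add_le_add_right ih _).trans (le_lintegral_add _ _)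
  refine ((Finset.sum_le_sum fun j _ ↦ hle j).trans (hsum _)).trans (le_of_eq ?_)
  refine setLIntegral_congr_fun hAm fun y hy ↦ ?_
  simp only
  rw [(hpt y hy).2, ENNReal.ofReal_sum_of_nonneg fun _ _ ↦ by positivity]

/-- The coordinate projections of the part of a curve in a ball have total area at most the area
of that part. -/
theorem sum_volume_projections_le_curveArea [T2Space M] [CompactSpace S] [Nonempty S]
    [MeasurableSpace S] [BorelSpace S] (he : IsAdaptedPair Ω U L R e J)
    (hw : IsJHolomorphicCurve J bdMinus bdPlus w)
    (hadapted : IsProperlyAdapted L R e bdMinus bdPlus w) {r : ℝ} (hrR : r < R) :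
    ∑ j : Fin n, volume ((fun p ↦ ballCoord R e w p j) '' (w ⁻¹' (e '' Metric.closedBall 0 r)))
      ≤ curveArea Ω w (e '' Metric.closedBall 0 r) := by
  set V : Set S := w ⁻¹' (e '' Metric.closedBall 0 r) with hV
  have hVR : V ⊆ w ⁻¹' (e '' Metric.ball 0 R) :=
    preimage_mono (image_mono (Metric.closedBall_subset_ball hrR))
  have hVc : IsClosed V :=
    (isCompact_image_closedBall he.ball hrR.le).isClosed.preimage hw.continuous
  have := ChartedSpace.secondCountable_of_sigmaCompact ClosedHalfPlane S
  have hbd : IsOpen (halfPlaneℝ.boundary S)ᶜ := by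
    have := isManifold_halfPlaneℝ (S := S)
    exact (halfPlaneℝ.isClosed_boundary (n := ∞) (by simp)).isOpen_compl
  obtain ⟨c, B, hB, hcover⟩ := exists_seq_isCompact_cover w
    (fun c ↦ (chartAt ClosedHalfPlane c).source) (fun c ↦ (chartAt ClosedHalfPlane c).open_source)
    (fun c ↦ mem_chart_source _ c) hbd
  have hBsource : ∀ k, B k ⊆ (chartAt ClosedHalfPlane (c k)).source := fun k ↦
    (hB k).2.1.trans inter_subset_left
  -- Points whose image was already covered by an earlier piece. Removing them makes the images of
  -- the `A k` disjoint, so multiple parts count once.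
  set X : ℕ → Set S := fun k ↦ ⋃ l ∈ Finset.range k, w ⁻¹' (w '' B l) with hX
  have hXc : ∀ k, IsClosed (X k) := fun k ↦ isClosed_biUnion_finset fun l _ ↦
    ((hB l).1.image hw.continuous).isClosed.preimage hw.continuous
  set A : ℕ → Set S := fun k ↦ (B k ∩ V) \ X k with hA
  have hAB : ∀ k, A k ⊆ B k := fun k p hp ↦ hp.1.1
  have hAV : ∀ k, A k ⊆ V := fun k p hp ↦ hp.1.2
  have hAmeas : ∀ k, MeasurableSet (A k) := fun k ↦
    ((hB k).1.isClosed.inter hVc).measurableSet.diff (hXc k).measurableSet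
  have himage : ∀ k, MeasurableSet (extChartAt halfPlaneℝ (c k) '' A k) := by
    intro k
    set φ := extChartAt halfPlaneℝ (c k) with hφ
    have hs : B k ∩ V ⊆ φ.source := by
      rw [hφ, extChartAt_source]
      exact inter_subset_left.trans (hBsource k)
    have hcont : ContinuousOn φ (B k ∩ V) := (continuousOn_extChartAt (c k)).mono hs
    have h1 : IsCompact (B k ∩ V) := (hB k).1.inter_right hVc
    -- Written as a difference of compact sets inside one chart domain, `A k` has a measurable image
    -- under the injective chart.
    have h2 : A k = (B k ∩ V) \ (B k ∩ V ∩ X k) := sdiff_self_inter.symm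
    rw [h2, (φ.injOn.mono hs).image_sdiff_subset inter_subset_left]
    exact (h1.image_of_continuousOn hcont).measurableSet.diff
      ((h1.inter_right (hXc k)).image_of_continuousOn (hcont.mono inter_subset_left)).measurableSet
  have hdisj : Pairwise fun k l ↦ Disjoint (w '' A k) (w '' A l) := by
    have key : ∀ k l, k < l → Disjoint (w '' A k) (w '' A l) := by
      intro k l hkl
      rw [Set.disjoint_left]
      rintro _ ⟨p, hp, rfl⟩ ⟨q, hq, hqp⟩
      refine hq.2 (mem_iUnion₂.2 ⟨k, Finset.mem_range.2 hkl, p, hAB k hp, hqp.symm⟩)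
    intro k l hkl
    rcases lt_or_gt_of_ne hkl with h | h
    · exact key k l h
    · exact (key l k h).symm
  have hpiece : ∀ k, ∑ j, volume ((fun p ↦ ballCoord R e w p j) '' A k) ≤
      ∫⁻ y in extChartAt halfPlaneℝ (c k) '' A k, ENNReal.ofReal
        (Ω (inChart w (c k) y) (chartDeriv w (c k) y 1) (chartDeriv w (c k) y Complex.I)) :=
    fun k ↦ sum_volume_image_le_lintegral he hw hadapted ((hAB k).trans (hBsource k))
      (Set.disjoint_left.2 fun p hp ↦ ((hB k).2.1 (hAB k hp)).2) ((hAV k).trans hVR) (himage k)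
  have hproj : ∀ j : Fin n, volume ((fun p ↦ ballCoord R e w p j) '' V)
      ≤ ∑' k, volume ((fun p ↦ ballCoord R e w p j) '' A k) := by
    intro j
    set Z : Set S := {p | w p ∈ e '' Metric.ball 0 R ∧
      (p ∈ (halfPlaneℝ.boundary S)ᶜ → ¬ ∃ N ∈ nhds p, InjOn w N)} with hZ
    have hsub : (fun p ↦ ballCoord R e w p j) '' V ⊆ (fun p ↦ ballCoord R e w p j) '' Z ∪
        ⋃ k, (fun p ↦ ballCoord R e w p j) '' A k := by
      rintro _ ⟨p, hp, rfl⟩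
      by_cases hpZ : p ∈ Z
      · exact Or.inl ⟨p, hpZ, rfl⟩
      · right
        have h1 : p ∈ (halfPlaneℝ.boundary S)ᶜ ∧ ∃ N ∈ nhds p, InjOn w N := by
          by_contra hcon
          exact hpZ ⟨hVR hp, fun h h' ↦ hcon ⟨h, h'⟩⟩
        have h2 : ∃ k, w p ∈ w '' B k := by
          obtain ⟨k, hk⟩ := hcover p h1.1 h1.2
          exact ⟨k, p, hk, rfl⟩
        classical
        -- In the first piece whose image contains `w p`, a point `q` with `w q = w p` survives the
        -- removal; it has the same projection as `p`.
        obtain ⟨q, hq, hqp⟩ := Nat.find_spec h2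
        refine mem_iUnion.2 ⟨Nat.find h2, q, ⟨⟨hq, ?_⟩, ?_⟩, ?_⟩
        · change w q ∈ e '' Metric.closedBall 0 r
          rw [hqp]
          exact hp
        · intro hqX
          obtain ⟨l, hl, hlq⟩ := mem_iUnion₂.1 hqX
          refine Nat.find_min h2 (Finset.mem_range.1 hl) ?_
          rw [← hqp]
          exact hlq
        · simp only [ballCoord, hqp]
    refine (measure_mono hsub).trans ((measure_union_le _ _).trans ?_)
    rw [volume_image_ballCoord_eq_zero he hw hadapted j, zero_add]
    exact measure_iUnion_le _
  calc ∑ j : Fin n, volume ((fun p ↦ ballCoord R e w p j) '' V)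
      ≤ ∑ j : Fin n, ∑' k, volume ((fun p ↦ ballCoord R e w p j) '' A k) :=
        Finset.sum_le_sum fun j _ ↦ hproj j
    _ = ∑' k, ∑ j : Fin n, volume ((fun p ↦ ballCoord R e w p j) '' A k) :=
        (Summable.tsum_finsetSum fun j _ ↦ ENNReal.summable).symm
    _ ≤ ∑' k, ∫⁻ y in extChartAt halfPlaneℝ (c k) '' A k, ENNReal.ofReal
          (Ω (inChart w (c k) y) (chartDeriv w (c k) y 1) (chartDeriv w (c k) y Complex.I)) :=
        ENNReal.tsum_le_tsum hpiece
    _ ≤ curveArea Ω w (e '' Metric.closedBall 0 r) :=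
        le_iSup₂_of_le c A <| le_iSup₂_of_le
          (fun k ↦ ⟨hAmeas k, (hAB k).trans (hBsource k), (hB k).2.2.mono (hAB k),
            image_subset_iff.2 (hAV k)⟩) hdisj le_rfl

/-- The projections are bounded, hence of finite area, so the real inequality for their areas
transfers to `ℝ≥0∞`. Strictness of `r < R` keeps the closed `r`-ball inside the open ball where the
coordinates are holomorphic. -/
theorem ofReal_le_curveArea_of_lt [T2Space M] [CompactSpace S] [ConnectedSpace S]
    [MeasurableSpace S] [BorelSpace S] (he : IsAdaptedPair Ω U L R e J)
    (hw : IsJHolomorphicCurve J bdMinus bdPlus w)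
    (hadapted : IsProperlyAdapted L R e bdMinus bdPlus w) (hcenter : e 0 ∈ range w) {r : ℝ}
    (hr : 0 < r) (hrR : r < R) :
    ENNReal.ofReal (Real.pi * r ^ 2 / 2) ≤ curveArea Ω w (e '' Metric.closedBall 0 r) := by
  refine le_trans ?_ (sum_volume_projections_le_curveArea he hw hadapted hrR)
  have h1 := pi_mul_sq_le_sum_area_projections he hw hadapted hcenter hr hrR
  have h2 : ∀ j : Fin n,
      volume ((fun p ↦ ballCoord R e w p j) '' (w ⁻¹' (e '' Metric.closedBall 0 r))) ≠ ⊤ := by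
    intro j
    refine ne_top_of_le_ne_top (IsCompact.measure_lt_top (isCompact_closedBall (0 : ℂ) R)).ne
      (measure_mono ?_)
    rintro _ ⟨p, hp, rfl⟩
    have h3 := ballCoord_mem he.ball (Metric.closedBall_subset_closedBall hrR.le) hp
    rw [mem_closedBall_zero_iff] at h3 ⊢
    exact (PiLp.norm_apply_le _ j).trans (h3.trans hrR.le)
  rw [← ENNReal.ofReal_toReal (ENNReal.sum_ne_top.2 fun j _ ↦ h2 j),
    ENNReal.toReal_sum fun j _ ↦ h2 j]
  refine ENNReal.ofReal_le_ofReal ?_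
  simp only [measureReal_def] at h1
  linarith

end Curve

/-- Half of the monotonicity inequality: a `J`-holomorphic curve through the centre of a
`(U, L)`-adapted symplectic ball, with the part `∂₋C` of its boundary on `L` and the part `∂₊C`
outside the open ball, has area at least `π r² / 2` in every concentric ball of radius `r ≤ R`. -/
theorem mainTheorem6 {n : ℕ} {M : Type*} [TopologicalSpace M] [T2Space M]
    [ChartedSpace (RSpace n) M] [IsManifold (𝓡 (2 * n)) ∞ M]
    (Ω : ∀ x : M, TangentSpace (𝓡 (2 * n)) x →L[ℝ] TangentSpace (𝓡 (2 * n)) x →L[ℝ] ℝ)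
    (hΩ : IsSymplecticForm Ω)
    (L U : Set M) (hL : IsLagrangian Ω L) (hU : IsOpen U)
    (R : ℝ) (hR : 0 < R) (e : CSpace n → M)
    (J : ∀ x : M, TangentSpace (𝓡 (2 * n)) x →L[ℝ] TangentSpace (𝓡 (2 * n)) x)
    (he : IsAdaptedPair Ω U L R e J)
    {S : Type*} [TopologicalSpace S] [T2Space S] [CompactSpace S] [ConnectedSpace S]
    [ChartedSpace ClosedHalfPlane S] [IsManifold halfPlaneℂ ω S]
    [MeasurableSpace S] [BorelSpace S]
    (bdMinus bdPlus : Set S) (w : S → M)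
    (hw : IsJHolomorphicCurve J bdMinus bdPlus w)
    (hadapted : IsProperlyAdapted L R e bdMinus bdPlus w)
    (hcenter : e 0 ∈ range w) (r : ℝ) (hr : 0 < r) (hrR : r ≤ R) :
    ENNReal.ofReal (Real.pi * r ^ 2 / 2) ≤ curveArea Ω w (e '' Metric.closedBall 0 r) := by
  -- The case `r = R` is reached by letting `t` increase to `r`: the lower bound is continuous and
  -- the area is monotone in the ball.
  refine le_of_tendsto (x := nhdsWithin r (Iio r))
    (f := fun t ↦ ENNReal.ofReal (Real.pi * t ^ 2 / 2)) ?_ ?_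
  · have h : Continuous fun t : ℝ ↦ ENNReal.ofReal (Real.pi * t ^ 2 / 2) :=
      ENNReal.continuous_ofReal.comp (by fun_prop)
    exact (h.tendsto r).mono_left nhdsWithin_le_nhds
  · filter_upwards [Ioo_mem_nhdsLT hr] with t ht
    exact (ofReal_le_curveArea_of_lt he hw hadapted hcenter ht.1 (ht.2.trans_le hrR)).trans
      (curveArea_mono (image_mono (Metric.closedBall_subset_closedBall ht.2.le)))
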